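/- (a) There is a continuous convex function $f:\mathbb{R}^2\to\mathbb{R}$ whose unique minimizer is the origin $O$ and all of whose nonconstant subgradient trajectories spiral infinitely many times around $O$. Moreover $f$ can be chosen with self-similar nested sublevel sets: there are an angle $\alpha\in(0,\pi)$, compact convex sets $C_k\subset\mathbb{R}^2$ ($k\ge 0$) and reals $\lambda_k$ strictly decreasing to $f(O)=\min f$ such that $C_{k+1}\subset\operatorname{int}C_k$, $\{f\le\lambda_k\}=C_k$ and $C_{k+4}=\mathcal{T}(C_k)$ for all $k$, where $\mathcal{T}$ is the homothety of center $O$ and ratio $1/2$ followed by the rotation of center $O$ and angle $\alpha$. Precisely, for every $x_0\neq O$ the system $\dot\gamma(t)\in-\partial f(\gamma(t))$ for a.e. $t\ge 0$, $\gamma(0)=x_0$, where $\partial f(x)=\{p : f(y)\ge f(x)+\langle p,y-x\rangle\ \forall y\in\mathbb{R}^2\}$, has an absolutely continuous solution $\gamma:[0,\infty)\to\mathbb{R}^2$, and every such solution satisfies: 1. $\gamma(t)\to O$ as $t\to\infty$, and $\gamma(t)\ne O$ for all $t\ge 0$; 2. there is a continuous $\theta:[0,\infty)\to\mathbb{R}$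 with $\gamma(t)=\|\gamma(t)\|(\cos\theta(t),\sin\theta(t))$ for all $t\ge0$ and $|\theta(t)|\to\infty$ as $t\to\infty$; 3. the secants $\gamma(t)/\|\gamma(t)\|$ do not converge as $t\to\infty$. (b) For every integer $m\ge1$ there is a convex function $f:\mathbb{R}^2\to\mathbb{R}$ of class $C^m$ on $\mathbb{R}^2$ and of class $C^\infty$ on $\mathbb{R}^2\setminus\{O\}$, with unique minimizer $O$, such that for every $x_0\ne O$ the gradient system $\dot\gamma(t)=-\nabla f(\gamma(t))$, $t\ge0$, $\gamma(0)=x_0$, has a solution $\gamma:[0,\infty)\to\mathbb{R}^2$, and every such solution satisfies 1, 2 and 3. -/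

import Mathlib

open Set Filter Topology MeasureTheory
open scoped ContDiff Gradient

/-- The Euclidean plane `ℝ²`. -/
abbrev Plane : Type := EuclideanSpace ℝ (Fin 2)

/-- The subdifferential `∂f(x)` (in the sense of convex analysis) of `f : ℝ² → ℝ` at `x`. -/
def subdifferential (f : Plane → ℝ) (x : Plane) : Set Plane :=
  {p | ∀ y, f x + inner ℝ p (y - x) ≤ f y}

/-- `γ : [0, ∞) → ℝ²` is an absolutely continuous solution of the subgradient system
`γ'(t) ∈ -∂f(γ(t))` for a.e. `t ≥ 0`, `γ(0) = x₀`.  Absolute continuity means that `γ` is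
differentiable almost everywhere and is the integral of its (locally integrable) derivative.
The values of `γ` at negative times play no role. -/
structure IsSubgradientTrajectory (f : Plane → ℝ) (x₀ : Plane) (γ : ℝ → Plane) : Prop where
  initial : γ 0 = x₀
  differentiable_ae : ∀ᵐ t ∂(volume.restrict (Ioi (0 : ℝ))), DifferentiableAt ℝ γ t
  integrable : ∀ t₁ t₂ : ℝ, 0 ≤ t₁ → t₁ ≤ t₂ → IntervalIntegrable (deriv γ) volume t₁ t₂
  integral_eq : ∀ t₁ t₂ : ℝ, 0 ≤ t₁ → t₁ ≤ t₂ → γ t₂ = γ t₁ + ∫ t in t₁..t₂, deriv γ t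
  inclusion : ∀ᵐ t ∂(volume.restrict (Ioi (0 : ℝ))), -deriv γ t ∈ subdifferential f (γ t)

/-- `γ : [0, ∞) → ℝ²` is a (classical) solution of the gradient system
`γ'(t) = -∇f(γ(t))`, `t ≥ 0`, `γ(0) = x₀` (with the one-sided derivative at `t = 0`). -/
structure IsGradientTrajectory (f : Plane → ℝ) (x₀ : Plane) (γ : ℝ → Plane) : Prop where
  initial : γ 0 = x₀
  hasDeriv : ∀ t : ℝ, 0 ≤ t → HasDerivWithinAt γ (-(∇ f (γ t))) (Ici 0) t

/-- The curve `γ : [0, ∞) → ℝ²` turns infinitely many times around the point `p`: it never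
meets `p`, and a continuous determination `θ` of its polar angle about `p` satisfies
`|θ(t)| → ∞` as `t → ∞` (so `θ → +∞` or `θ → -∞`, since `θ` is continuous).  Two continuous
determinations differ by a constant, so the choice of `θ` is immaterial. -/
def SpiralsAround (γ : ℝ → Plane) (p : Plane) : Prop :=
  (∀ t : ℝ, 0 ≤ t → γ t ≠ p) ∧
  ∃ θ : ℝ → ℝ, ContinuousOn θ (Ici 0) ∧
    (∀ t : ℝ, 0 ≤ t → γ t = p + ‖γ t - p‖ • !₂[Real.cos (θ t), Real.sin (θ t)]) ∧
    Tendsto (fun t => |θ t|) atTop atTop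

/-- The secants `(γ(t) - p) / ‖γ(t) - p‖` converge to some direction as `t → ∞`. -/
def SecantsConverge (γ : ℝ → Plane) (p : Plane) : Prop :=
  ∃ d : Plane, Tendsto (fun t => ‖γ t - p‖⁻¹ • (γ t - p)) atTop (𝓝 d)

/-- The similarity `r ∘ h` of the plane, where `h` is the homothety of center `0` and ratio `1/2`
and `r` is the rotation of center `0` and angle `α`. -/
noncomputable def halfRotation (α : ℝ) (x : Plane) : Plane :=
  (1 / 2 : ℝ) • !₂[Real.cos α * x 0 - Real.sin α * x 1, Real.sin α * x 0 + Real.cos α * x 1]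

/-- Some sublevel sets of `f` form a self-similar sequence: there are compact convex sets
`C 0 ⊇ C 1 ⊇ …`, each one contained in the interior of the previous one, such that the
rotation-homothety of angle `α ∈ (0, π)` and ratio `1/2` maps `C k` onto `C (k + 4)`, and levels
`lam k`, decreasing to `f 0`, such that `{f ≤ lam k} = C k` for all `k`. -/
def HasSelfSimilarSublevels (f : Plane → ℝ) : Prop :=
  ∃ (α : ℝ) (C : ℕ → Set Plane) (lam : ℕ → ℝ),
    0 < α ∧ α < Real.pi ∧
    (∀ k, Convex ℝ (C k)) ∧ (∀ k, IsCompact (C k)) ∧ (∀ k, C (k + 1) ⊆ interior (C k)) ∧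
    (∀ k, C (k + 4) = halfRotation α '' C k) ∧
    StrictAnti lam ∧ Tendsto lam atTop (𝓝 (f 0)) ∧
    ∀ k, {x | f x ≤ lam k} = C k

/-! A single explicit family settles both parts. In polar coordinates, with J = i + 4 and ε = 1/(20
J), take f = r^(2J) (1 + ε cos φ), where the phase is φ = 2θ + 2 log r. Shrinking by a factor λ and
rotating by log λ leaves φ unchanged, so it multiplies f by a constant; this gives the self-similar
sublevel sets. At the origin f is finitely smooth, with order growing with i, because the powers of
r absorb the oscillation of log r. It is convex because ε is small compared with the Hessian of
r^(2J).

Put w = r^(2J-2). Along a gradient trajectory, θ' = 2εw sin φ and (log r²)' = -4w (J + ε (J cos φ -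
sin φ)), so φ' = -4w (J (1 + ε cos φ) - 2ε sin φ). To first order in ε the phase runs backwards and
the turning averages out. At second order a drift of constant sign remains, through the exact
identity θ' - (log(1 + ε cos φ))'/(2J) = 4ε² w sin² φ / (J (1 + ε cos φ)). Comparing the right side
with a small multiple of -φ' sin² φ bounds θ below by a constant minus a positive multiple of log
r². Since r → 0, θ → +∞ (`tendsto_angle_atTop`).

The remaining ingredients are two-sided bounds on the radial derivative
(`inner_gradient_spiralFun_bounds`), which give convergence to the origin without reaching it, and
the fact that a differentiable convex f has ∇f as its only subgradient, so part (a) reduces to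
gradient trajectories. -/

/-! ### Global existence of integral curves -/

/-- A bounded Lipschitz vector field has global integral curves. -/
theorem exists_integralCurve_of_lipschitz_of_bounded {E : Type*} [NormedAddCommGroup E]
    [NormedSpace ℝ E] [CompleteSpace E] {v : E → E} {K L : NNReal} (hv : LipschitzWith K v)
    (hb : ∀ x, ‖v x‖ ≤ L) (x₀ : E) :
    ∃ γ : ℝ → E, γ 0 = x₀ ∧ ∀ t, HasDerivAt γ (v (γ t)) t := by
  have key : ∀ n : ℕ, ∃ γ : ℝ → E, γ 0 = x₀ ∧
      ∀ t ∈ Ioo (-(n + 1 : ℝ)) (n + 1), HasDerivAt γ (v (γ t)) t := by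
    intro n
    have h0 : (0 : ℝ) ∈ Icc (-(n + 1 : ℝ)) (n + 1) := ⟨by linarith [n.cast_nonneg (α := ℝ)],
      by positivity⟩
    -- A curve of speed at most `L` cannot leave the ball of radius `L * (n + 1)` during this time,
    -- so the Picard–Lindelöf interval is as long as desired.
    have hp : IsPicardLindelof (fun _ ↦ v) (⟨0, h0⟩ : Icc (-(n + 1 : ℝ)) (n + 1)) x₀
        (L * (n + 1)) 0 L K := by
      apply IsPicardLindelof.of_time_independent (fun x _ ↦ hb x) hv.lipschitzOnWith
      simp
    obtain ⟨γ, h1, h2⟩ := hp.exists_eq_forall_mem_Icc_hasDerivWithinAt₀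
    exact ⟨γ, h1, fun t ht ↦ (h2 t (Ioo_subset_Icc_self ht)).hasDerivAt (Icc_mem_nhds ht.1 ht.2)⟩
  choose γ h0 hγ using key
  have huniq : ∀ m n : ℕ, m ≤ n → EqOn (γ m) (γ n) (Ioo (-(m + 1 : ℝ)) (m + 1)) := by
    intro m n hmn
    have hmn' : (m : ℝ) ≤ n := by exact_mod_cast hmn
    refine ODE_solution_unique_of_mem_Ioo (v := fun _ ↦ v) (s := fun _ ↦ univ) (K := K) (t₀ := 0)
      (fun t _ ↦ hv.lipschitzOnWith) ⟨by linarith [m.cast_nonneg (α := ℝ)], by positivity⟩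
      (fun t ht ↦ ⟨hγ m t ht, mem_univ _⟩)
      (fun t ht ↦ ⟨hγ n t ⟨by linarith [ht.1], by linarith [ht.2]⟩, mem_univ _⟩) (by rw [h0, h0])
  -- The local solutions agree on overlaps. The margin 1 in the radius `n + 1` keeps `t` interior
  -- even when `|t|` is an integer.
  refine ⟨fun t ↦ γ ⌈|t|⌉₊ t, by simpa using! h0 _, fun t ↦ ?_⟩
  have hmem : ∀ u : ℝ, u ∈ Ioo (-((⌈|u|⌉₊ : ℝ) + 1)) (⌈|u|⌉₊ + 1) := fun u ↦
    abs_lt.mp ((Nat.le_ceil |u|).trans_lt (lt_add_one _))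
  have hev : (fun u ↦ γ ⌈|u|⌉₊ u) =ᶠ[𝓝 t] γ (⌈|t|⌉₊ + 1) := by
    have : ∀ᶠ u in 𝓝 t, |u| < |t| + 1 := continuous_abs.continuousAt.eventually_lt_const (by simp)
    filter_upwards [this] with u hu
    refine huniq _ _ ?_ (hmem u)
    refine Nat.ceil_le.mpr (hu.le.trans ?_)
    push_cast
    linarith [Nat.le_ceil |t|]
  have h := hγ (⌈|t|⌉₊ + 1) t ⟨by push_cast; linarith [(hmem t).1],
    by push_cast; linarith [(hmem t).2]⟩
  have heq : γ ⌈|t|⌉₊ t = γ (⌈|t|⌉₊ + 1) t := hev.eq_of_nhds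
  refine HasDerivAt.congr_of_eventuallyEq ?_ hev
  change HasDerivAt _ (v (γ ⌈|t|⌉₊ t)) t
  rwa [heq]

/-- A `C¹` vector field pointing towards the origin has forward-complete integral curves. -/
theorem exists_forward_integralCurve {E : Type*} [NormedAddCommGroup E] [InnerProductSpace ℝ E]
    [FiniteDimensional ℝ E] {v : E → E} (hv : ContDiff ℝ 1 v) (hin : ∀ x, inner ℝ x (v x) ≤ 0)
    (x₀ : E) :
    ∃ γ : ℝ → E, γ 0 = x₀ ∧ ∀ t, 0 ≤ t → HasDerivWithinAt γ (v (γ t)) (Ici 0) t := by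
  -- The cutoff makes the field bounded and Lipschitz. Since the field points inward, the norm never
  -- increases, so the curve stays where the cutoff equals 1.
  let χ : ContDiffBump (0 : E) := ⟨‖x₀‖ + 1, ‖x₀‖ + 2, by positivity, by linarith⟩
  have hw : ContDiff ℝ 1 (fun x ↦ χ x • v x) := χ.contDiff.smul hv
  have hc : HasCompactSupport (fun x ↦ χ x • v x) := χ.hasCompactSupport.smul_right
  obtain ⟨K, hK⟩ := hw.lipschitzWith_of_hasCompactSupport hc one_ne_zero
  obtain ⟨L, hL⟩ := hc.exists_bound_of_continuous hw.continuous
  obtain ⟨γ, h0, hγ⟩ := exists_integralCurve_of_lipschitz_of_bounded (L := ⟨max L 0, le_max_right _ _⟩)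
    hK (fun x ↦ (hL x).trans (le_max_left _ _)) x₀
  refine ⟨γ, h0, fun t ht ↦ ?_⟩
  have hanti : Antitone (fun t ↦ ‖γ t‖ ^ 2) := by
    apply antitone_of_hasDerivAt_nonpos (fun t ↦ (hγ t).norm_sq)
    intro t
    change 2 * inner ℝ (γ t) (χ (γ t) • v (γ t)) ≤ 0
    rw [inner_smul_right]
    exact mul_nonpos_of_nonneg_of_nonpos zero_le_two
      (mul_nonpos_of_nonneg_of_nonpos χ.nonneg (hin (γ t)))
  have hle : ‖γ t‖ ≤ ‖x₀‖ := by
    have := hanti ht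
    simp only [h0] at this
    exact (sq_le_sq₀ (norm_nonneg _) (norm_nonneg _)).1 this
  have hone : χ (γ t) = 1 := χ.one_of_mem_closedBall (by simpa [χ] using hle.trans (by linarith))
  simpa [hone] using (hγ t).hasDerivWithinAt

/-! ### Log-periodic monomials -/

/-- The log-periodic monomial `s ^ k * (a cos (log s) + b sin (log s))`. -/
noncomputable def logOsc (k : ℕ) (a b s : ℝ) : ℝ :=
  s ^ k * (a * Real.cos (Real.log s) + b * Real.sin (Real.log s))

theorem abs_logOsc_le (k : ℕ) (a b : ℝ) {s : ℝ} (hs : 0 ≤ s) :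
    |logOsc k a b s| ≤ s ^ k * (|a| + |b|) := by
  rw [logOsc, abs_mul, abs_of_nonneg (pow_nonneg hs k)]
  gcongr
  refine (abs_add_le _ _).trans ?_
  rw [abs_mul, abs_mul]
  have h1 := Real.abs_cos_le_one (Real.log s)
  have h2 := Real.abs_sin_le_one (Real.log s)
  nlinarith [abs_nonneg a, abs_nonneg b]

/-- The family is closed under differentiation, each derivative costing one power of `s`. At 0 the
oscillating factor is bounded and `s ^ (k + 1)` is o(s), which is where `k ≠ 0` enters. -/
theorem hasDerivAt_logOsc {k : ℕ} (hk : k ≠ 0) (a b s : ℝ) :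
    HasDerivAt (logOsc (k + 1) a b) (logOsc k ((k + 1) * a + b) ((k + 1) * b - a) s) s := by
  rcases eq_or_ne s 0 with rfl | hs
  · have h0 : logOsc k ((k + 1) * a + b) ((k + 1) * b - a) 0 = 0 := by simp [logOsc, hk]
    rw [h0, hasDerivAt_iff_isLittleO]
    have hB : (fun s : ℝ ↦ a * Real.cos (Real.log s) + b * Real.sin (Real.log s)) =O[𝓝 0]
        (fun _ ↦ (1 : ℝ)) := by
      refine Asymptotics.IsBigO.of_bound (|a| + |b|) (Eventually.of_forall fun s ↦ ?_)
      have := abs_logOsc_le 0 a b (s := |s|) (abs_nonneg s)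
      simpa [logOsc] using this
    have hA : (fun s : ℝ ↦ s ^ (k + 1)) =o[𝓝 0] (fun s ↦ s) := by
      simpa using Asymptotics.isLittleO_pow_pow (𝕜 := ℝ) (m := 1) (n := k + 1) (by omega)
    simpa [logOsc] using! hA.mul_isBigO hB
  · have hl := Real.hasDerivAt_log hs
    have h := ((hasDerivAt_id s).pow (k + 1)).mul ((hl.cos.const_mul a).add (hl.sin.const_mul b))
    convert! h using 1
    simp only [logOsc, id, Pi.pow_apply, Pi.add_apply, Nat.add_sub_cancel]
    push_cast
    field_simp
    ring

theorem contDiff_logOsc (n : ℕ) (a b : ℝ) : ContDiff ℝ n (logOsc (n + 1) a b) := by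
  induction n generalizing a b with
  | zero =>
    rw [Nat.cast_zero, contDiff_zero, continuous_iff_continuousAt]
    intro s
    rcases eq_or_ne s 0 with rfl | hs
    · have h0 : logOsc (0 + 1) a b 0 = 0 := by simp [logOsc]
      rw [ContinuousAt, h0]
      refine squeeze_zero_norm (a := fun s ↦ |s| * (|a| + |b|)) (fun s ↦ ?_) ?_
      · have := abs_logOsc_le 1 a b (s := |s|) (abs_nonneg s)
        simpa [logOsc, abs_mul] using this
      · have : Continuous fun s : ℝ ↦ |s| * (|a| + |b|) := by fun_prop
        simpa using this.tendsto 0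
    · have := Real.continuousAt_log hs
      unfold logOsc
      fun_prop
  | succ n ih =>
    have hd := fun s ↦ hasDerivAt_logOsc (Nat.succ_ne_zero n) a b s
    push_cast
    rw [contDiff_succ_iff_deriv]
    refine ⟨fun s ↦ (hd s).differentiableAt, by simp, ?_⟩
    rw [show deriv (logOsc (n + 1 + 1) a b) = _ from funext fun s ↦ (hd s).deriv]
    exact ih _ _

theorem contDiffAt_logOsc {n : WithTop ℕ∞} (k : ℕ) (a b : ℝ) {s : ℝ} (hs : s ≠ 0) :
    ContDiffAt ℝ n (logOsc k a b) s := by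
  have h : ContDiffAt ℝ n Real.log s := Real.contDiffAt_log.2 hs
  exact (contDiffAt_id.pow k).mul
    ((contDiffAt_const.mul h.cos).add (contDiffAt_const.mul h.sin))

theorem abs_logOsc_deriv_coeff_le (k : ℕ) (a b : ℝ) :
    |(k + 1) * a + b| + |(k + 1) * b - a| ≤ (k + 2) * (|a| + |b|) := by
  have h1 := abs_add_le ((k + 1) * a) b
  have h2 := abs_sub ((k + 1) * b) a
  rw [abs_mul, abs_of_nonneg (by positivity : (0 : ℝ) ≤ k + 1)] at h1 h2
  linarith

/-! ### The spiral potential and its partial derivatives -/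

/-- The explicit convex function whose gradient trajectories spiral: in polar coordinates it is
`r ^ (2 * i + 6) * (1 + ε * cos (2 * θ + 2 * log r))` with `ε = 1 / (20 * (i + 3))`. -/
noncomputable def spiralPotential (i : ℕ) (X Y : ℝ) : ℝ :=
  (X ^ 2 + Y ^ 2) ^ (i + 3) + 1 / (20 * (i + 3)) *
    ((X ^ 2 - Y ^ 2) * logOsc (i + 2) 1 0 (X ^ 2 + Y ^ 2) -
      2 * X * Y * logOsc (i + 2) 0 1 (X ^ 2 + Y ^ 2))

/-- The real part of `z ^ 2 * exp (I * log |z| ^ 2)`. -/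
noncomputable def spiralRe (X Y : ℝ) : ℝ :=
  (X ^ 2 - Y ^ 2) * Real.cos (Real.log (X ^ 2 + Y ^ 2)) -
    2 * X * Y * Real.sin (Real.log (X ^ 2 + Y ^ 2))

/-- The imaginary part of `z ^ 2 * exp (I * log |z| ^ 2)`. -/
noncomputable def spiralIm (X Y : ℝ) : ℝ :=
  (X ^ 2 - Y ^ 2) * Real.sin (Real.log (X ^ 2 + Y ^ 2)) +
    2 * X * Y * Real.cos (Real.log (X ^ 2 + Y ^ 2))

theorem spiralRe_sq_add_spiralIm_sq (X Y : ℝ) :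
    spiralRe X Y ^ 2 + spiralIm X Y ^ 2 = (X ^ 2 + Y ^ 2) ^ 2 := by
  rw [spiralRe, spiralIm]
  linear_combination (X ^ 2 + Y ^ 2) ^ 2 * Real.sin_sq_add_cos_sq (Real.log (X ^ 2 + Y ^ 2))

theorem abs_spiralRe_le (X Y : ℝ) : |spiralRe X Y| ≤ X ^ 2 + Y ^ 2 :=
  abs_le_of_sq_le_sq (by nlinarith [spiralRe_sq_add_spiralIm_sq X Y]) (by positivity)

theorem abs_spiralIm_le (X Y : ℝ) : |spiralIm X Y| ≤ X ^ 2 + Y ^ 2 :=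
  abs_le_of_sq_le_sq (by nlinarith [spiralRe_sq_add_spiralIm_sq X Y]) (by positivity)

theorem spiralPotential_eq (i : ℕ) (X Y : ℝ) :
    spiralPotential i X Y = (X ^ 2 + Y ^ 2) ^ (i + 2) *
      ((X ^ 2 + Y ^ 2) + 1 / (20 * (i + 3)) * spiralRe X Y) := by
  simp only [spiralPotential, logOsc, spiralRe]
  ring

/-- The first partial derivative of `spiralPotential`. -/
noncomputable def spiralPotentialX (i : ℕ) (X Y : ℝ) : ℝ :=
  2 * X * ((i + 3) * (X ^ 2 + Y ^ 2) ^ (i + 2) + 1 / (20 * (i + 3)) *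
    ((X ^ 2 - Y ^ 2) * logOsc (i + 1) (i + 2) (-1) (X ^ 2 + Y ^ 2) -
      2 * X * Y * logOsc (i + 1) 1 (i + 2) (X ^ 2 + Y ^ 2))) + 1 / (20 * (i + 3)) *
    (2 * X * logOsc (i + 2) 1 0 (X ^ 2 + Y ^ 2) - 2 * Y * logOsc (i + 2) 0 1 (X ^ 2 + Y ^ 2))

/-- The second partial derivative of `spiralPotential`. -/
noncomputable def spiralPotentialY (i : ℕ) (X Y : ℝ) : ℝ :=
  2 * Y * ((i + 3) * (X ^ 2 + Y ^ 2) ^ (i + 2) + 1 / (20 * (i + 3)) *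
    ((X ^ 2 - Y ^ 2) * logOsc (i + 1) (i + 2) (-1) (X ^ 2 + Y ^ 2) -
      2 * X * Y * logOsc (i + 1) 1 (i + 2) (X ^ 2 + Y ^ 2))) - 1 / (20 * (i + 3)) *
    (2 * Y * logOsc (i + 2) 1 0 (X ^ 2 + Y ^ 2) + 2 * X * logOsc (i + 2) 0 1 (X ^ 2 + Y ^ 2))

theorem radial_spiralPotential (i : ℕ) (X Y : ℝ) :
    X * spiralPotentialX i X Y + Y * spiralPotentialY i X Y =
      2 * (X ^ 2 + Y ^ 2) ^ (i + 2) * ((i + 3) * (X ^ 2 + Y ^ 2) + 1 / (20 * (i + 3)) *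
        ((i + 3) * spiralRe X Y - spiralIm X Y)) := by
  simp only [spiralPotentialX, spiralPotentialY, logOsc, spiralRe, spiralIm]
  ring

/-- Only the oscillating term depends on the angle, so the torque is of order ε. -/
theorem angular_spiralPotential (i : ℕ) (X Y : ℝ) :
    X * spiralPotentialY i X Y - Y * spiralPotentialX i X Y =
      -(2 * (1 / (20 * (i + 3))) * (X ^ 2 + Y ^ 2) ^ (i + 2) * spiralIm X Y) := by
  simp only [spiralPotentialX, spiralPotentialY, logOsc, spiralIm]
  ring

theorem HasDerivAt.spiralPotential (i : ℕ) {X Y : ℝ → ℝ} {X' Y' t : ℝ} (hX : HasDerivAt X X' t)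
    (hY : HasDerivAt Y Y' t) :
    HasDerivAt (fun t ↦ spiralPotential i (X t) (Y t))
      (spiralPotentialX i (X t) (Y t) * X' + spiralPotentialY i (X t) (Y t) * Y') t := by
  have hS : HasDerivAt (fun t ↦ X t ^ 2 + Y t ^ 2) (2 * X t * X' + 2 * Y t * Y') t := by
    simpa using! (hX.pow 2).add (hY.pow 2)
  have hA : HasDerivAt (fun t ↦ X t ^ 2 - Y t ^ 2) (2 * X t * X' - 2 * Y t * Y') t := by
    simpa using! (hX.pow 2).sub (hY.pow 2)
  have hB : HasDerivAt (fun t ↦ 2 * X t * Y t) (2 * X' * Y t + 2 * X t * Y') t :=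
    (hX.const_mul 2).mul hY
  have h1 := (hasDerivAt_logOsc (Nat.succ_ne_zero i) 1 0 (X t ^ 2 + Y t ^ 2)).comp t hS
  have h2 := (hasDerivAt_logOsc (Nat.succ_ne_zero i) 0 1 (X t ^ 2 + Y t ^ 2)).comp t hS
  have h := (hS.pow (i + 3)).add (((hA.mul h1).sub (hB.mul h2)).const_mul (1 / (20 * ((i : ℝ) + 3))))
  refine HasDerivAt.congr_deriv h ?_
  simp only [spiralPotentialX, spiralPotentialY, Function.comp, Nat.succ_eq_add_one]
  push_cast
  simp only [logOsc]
  ring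

/-! ### Second derivative estimates for convexity -/

/-- The left side is the second derivative along a line of a product A · h(S), where A is a
quadratic form, S = |x|² and h is a log-periodic monomial: `A₁`, `S₁` are first derivatives, `A₂`
and `2 * N` second ones. All terms have the same homogeneity, hence the common factor `N * s ^ (i +
3)`. -/
theorem abs_mul_logOsc_deriv2_le (i : ℕ) (a b : ℝ) {s N A A₁ A₂ S₁ R : ℝ} (hs : 0 ≤ s) (hN : 0 ≤ N)
    (hA : |A| ≤ s) (hA₁ : |A₁| ≤ R) (hS₁ : |S₁| ≤ R) (hR : R ^ 2 = 4 * s * N) (hA₂ : |A₂| ≤ 2 * N) :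
    |A₂ * logOsc (i + 3) a b s +
      2 * (A₁ * S₁) * logOsc (i + 2) ((i + 3) * a + b) ((i + 3) * b - a) s +
      A * (S₁ ^ 2 * logOsc (i + 1) ((i + 2) * ((i + 3) * a + b) + ((i + 3) * b - a))
        ((i + 2) * ((i + 3) * b - a) - ((i + 3) * a + b)) s +
        2 * N * logOsc (i + 2) ((i + 3) * a + b) ((i + 3) * b - a) s)| ≤
      10 * (i + 4) ^ 2 * (N * s ^ (i + 3)) * (|a| + |b|) := by
  set h := logOsc (i + 3) a b s with hh
  set h₁ := logOsc (i + 2) ((i + 3) * a + b) ((i + 3) * b - a) s with hh₁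
  set h₂ := logOsc (i + 1) ((i + 2) * ((i + 3) * a + b) + ((i + 3) * b - a))
        ((i + 2) * ((i + 3) * b - a) - ((i + 3) * a + b)) s with hh₂
  set c := |a| + |b| with hc
  have hc0 : 0 ≤ c := by positivity
  have hi : (0 : ℝ) ≤ i := i.cast_nonneg
  have hR0 : 0 ≤ R := (abs_nonneg _).trans hA₁
  have e1 := abs_logOsc_deriv_coeff_le (i + 2) a b
  have e2 := abs_logOsc_deriv_coeff_le (i + 1) ((i + 3) * a + b) ((i + 3) * b - a)
  push_cast at e1 e2
  rw [show (i : ℝ) + 2 + 1 = i + 3 by ring, show (i : ℝ) + 2 + 2 = i + 4 by ring] at e1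
  rw [show (i : ℝ) + 1 + 1 = i + 2 by ring, show (i : ℝ) + 1 + 2 = i + 3 by ring] at e2
  have b0 : |h| ≤ s ^ (i + 3) * c := abs_logOsc_le _ _ _ hs
  have b1 : |h₁| ≤ s ^ (i + 2) * ((i + 4) * c) :=
    (abs_logOsc_le _ _ _ hs).trans (mul_le_mul_of_nonneg_left e1 (by positivity))
  have b2 : |h₂| ≤ s ^ (i + 1) * ((i + 4) * ((i + 4) * c)) := by
    refine (abs_logOsc_le _ _ _ hs).trans (mul_le_mul_of_nonneg_left (e2.trans ?_) (by positivity))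
    gcongr
    linarith
  have t1 : |A₂ * h| ≤ 2 * N * (s ^ (i + 3) * c) := by
    rw [abs_mul]; gcongr
  have hAS : |2 * (A₁ * S₁)| ≤ 2 * (4 * s * N) := by
    rw [abs_mul, abs_mul, abs_two, ← hR, sq]; gcongr
  have t2 : |2 * (A₁ * S₁) * h₁| ≤ 2 * (4 * s * N) * (s ^ (i + 2) * ((i + 4) * c)) := by
    rw [abs_mul]; gcongr
  have hS2 : |S₁ ^ 2| ≤ 4 * s * N := by
    rw [← hR, abs_pow]; gcongr
  have t3 : |A * (S₁ ^ 2 * h₂ + 2 * N * h₁)| ≤ s * (4 * s * N * (s ^ (i + 1) *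
      ((i + 4) * ((i + 4) * c))) + 2 * N * (s ^ (i + 2) * ((i + 4) * c))) := by
    rw [abs_mul]
    gcongr
    refine (abs_add_le _ _).trans ?_
    rw [abs_mul (S₁ ^ 2), abs_mul (2 * N), abs_of_nonneg (by positivity : 0 ≤ 2 * N)]
    gcongr
  refine (abs_add_three _ _ _).trans ((add_le_add (add_le_add t1 t2) t3).trans ?_)
  -- With m = i + 4 the three bounds add up to the coefficient 4m² + 10m + 2, which is at most 10m².
  have hkey : 0 ≤ (6 * ((i : ℝ) + 4) ^ 2 - 10 * (i + 4) - 2) * (N * s ^ (i + 3) * c) :=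
    mul_nonneg (by nlinarith) (by positivity)
  refine le_of_sub_nonneg (hkey.trans_eq ?_)
  ring

/-- The second derivative of `spiralPotential` along the direction `(u, v)`. -/
theorem exists_hasDerivAt_spiralPotential_line (i : ℕ) {X Y : ℝ → ℝ} {u v t : ℝ}
    (hX : HasDerivAt X u t) (hY : HasDerivAt Y v t) :
    ∃ d, 0 ≤ d ∧ HasDerivAt (fun t ↦ spiralPotentialX (i + 1) (X t) (Y t) * u +
      spiralPotentialY (i + 1) (X t) (Y t) * v) d t := by
  have hS : HasDerivAt (fun t ↦ X t ^ 2 + Y t ^ 2) (2 * (X t * u + Y t * v)) t :=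
    ((hX.fun_pow 2).fun_add (hY.fun_pow 2)).congr_deriv (by simp; ring)
  have hA : HasDerivAt (fun t ↦ X t ^ 2 - Y t ^ 2) (2 * (X t * u - Y t * v)) t :=
    ((hX.fun_pow 2).fun_sub (hY.fun_pow 2)).congr_deriv (by simp; ring)
  have hB : HasDerivAt (fun t ↦ 2 * X t * Y t) (2 * (X t * v + Y t * u)) t :=
    ((hX.const_mul 2).fun_mul hY).congr_deriv (by ring)
  have hS₁ : HasDerivAt (fun t ↦ 2 * (X t * u + Y t * v)) (2 * (u ^ 2 + v ^ 2)) t :=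
    (((hX.mul_const u).fun_add (hY.mul_const v)).const_mul 2).congr_deriv (by ring)
  have hA₁ : HasDerivAt (fun t ↦ 2 * (X t * u - Y t * v)) (2 * (u ^ 2 - v ^ 2)) t :=
    (((hX.mul_const u).fun_sub (hY.mul_const v)).const_mul 2).congr_deriv (by ring)
  have hB₁ : HasDerivAt (fun t ↦ 2 * (X t * v + Y t * u)) (2 * (2 * u * v)) t :=
    (((hX.mul_const v).fun_add (hY.mul_const u)).const_mul 2).congr_deriv (by ring)
  set s := X t ^ 2 + Y t ^ 2 with hs
  set N := u ^ 2 + v ^ 2 with hN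
  have hs0 : 0 ≤ s := by positivity
  have hN0 : 0 ≤ N := by positivity
  have hi : (0 : ℝ) ≤ i := i.cast_nonneg
  have hosc (a b : ℝ) : HasDerivAt (fun t ↦ logOsc (i + 3) a b (X t ^ 2 + Y t ^ 2))
      (logOsc (i + 2) ((i + 3) * a + b) ((i + 3) * b - a) s * (2 * (X t * u + Y t * v))) t := by
    refine (((hasDerivAt_logOsc (k := i + 2) (by omega) a b s).comp t hS)).congr_deriv ?_
    push_cast
    ring_nf
  have hosc₁ (a b : ℝ) : HasDerivAt (fun t ↦ logOsc (i + 2) a b (X t ^ 2 + Y t ^ 2))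
      (logOsc (i + 1) ((i + 2) * a + b) ((i + 2) * b - a) s * (2 * (X t * u + Y t * v))) t := by
    refine (((hasDerivAt_logOsc (k := i + 1) (by omega) a b s).comp t hS)).congr_deriv ?_
    push_cast
    ring_nf
  have sqrt_sq : Real.sqrt (4 * s * N) ^ 2 = 4 * s * N := Real.sq_sqrt (by positivity)
  have bS : |2 * (X t * u + Y t * v)| ≤ Real.sqrt (4 * s * N) :=
    Real.abs_le_sqrt (by nlinarith [sq_nonneg (X t * v - Y t * u)])
  have bA₁ : |2 * (X t * u - Y t * v)| ≤ Real.sqrt (4 * s * N) :=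
    Real.abs_le_sqrt (by nlinarith [sq_nonneg (X t * v + Y t * u)])
  have bB₁ : |2 * (X t * v + Y t * u)| ≤ Real.sqrt (4 * s * N) :=
    Real.abs_le_sqrt (by nlinarith [sq_nonneg (X t * u - Y t * v)])
  have bA : |X t ^ 2 - Y t ^ 2| ≤ s :=
    abs_le.2 ⟨by nlinarith [sq_nonneg (X t)], by nlinarith [sq_nonneg (Y t)]⟩
  have bB : |2 * X t * Y t| ≤ s :=
    abs_le.2 ⟨by nlinarith [sq_nonneg (X t + Y t)], by nlinarith [sq_nonneg (X t - Y t)]⟩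
  have bA₂ : |2 * (u ^ 2 - v ^ 2)| ≤ 2 * N :=
    abs_le.2 ⟨by nlinarith [sq_nonneg u], by nlinarith [sq_nonneg v]⟩
  have bB₂ : |2 * (2 * u * v)| ≤ 2 * N :=
    abs_le.2 ⟨by nlinarith [sq_nonneg (u + v)], by nlinarith [sq_nonneg (u - v)]⟩
  have k1 := abs_mul_logOsc_deriv2_le i 1 0 hs0 hN0 bA bA₁ bS sqrt_sq bA₂
  have k2 := abs_mul_logOsc_deriv2_le i 0 1 hs0 hN0 bB bB₁ bS sqrt_sq bB₂
  have h1 := hosc 1 0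
  have h2 := hosc 0 1
  have h11 := hosc₁ ((i + 3) * 1 + 0) ((i + 3) * 0 - 1)
  have h21 := hosc₁ ((i + 3) * 0 + 1) ((i + 3) * 1 - 0)
  have hd := (((hS.fun_pow (i + 3)).fun_mul hS₁).const_mul ((i : ℝ) + 4)).fun_add
    ((((hA₁.fun_mul h1).fun_add (hA.fun_mul (h11.fun_mul hS₁))).fun_sub
      ((hB₁.fun_mul h2).fun_add (hB.fun_mul (h21.fun_mul hS₁)))).const_mul (1 / (20 * ((i : ℝ) + 4))))
  refine ⟨_, ?_, hd.congr_of_eventuallyEq (Eventually.of_forall fun t ↦ ?_)⟩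
  · rw [abs_le] at k1 k2
    simp only [abs_one, abs_zero, add_zero, zero_add, mul_one] at k1 k2
    have main := mul_le_mul_of_nonneg_left (sub_le_sub k1.1 k2.2)
      (by positivity : (0 : ℝ) ≤ 1 / (20 * (i + 4)))
    -- This fixes the 20 in ε: the two oscillating terms together cost at most (i + 4) N s^(i+3),
    -- half of the term 2 (i + 4) N s^(i+3) supplied by the pure power.
    have e : 1 / (20 * ((i : ℝ) + 4)) * (-(10 * (i + 4) ^ 2 * (N * s ^ (i + 3))) -
        10 * (i + 4) ^ 2 * (N * s ^ (i + 3))) = -((i + 4) * (N * s ^ (i + 3))) := by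
      field_simp
      ring
    rw [e] at main
    have hpos : 0 ≤ ((i : ℝ) + 4) * (N * s ^ (i + 3)) := by positivity
    have hpos2 : 0 ≤ ((i : ℝ) + 4) * ((i + 3) * s ^ (i + 2) *
      (2 * (X t * u + Y t * v)) ^ 2) := by positivity
    simp only [show i + 3 - 1 = i + 2 from rfl]
    push_cast
    ring_nf at main hpos hpos2 ⊢
    linarith
  · simp only [spiralPotentialX, spiralPotentialY]
    push_cast
    rw [show i + 1 + 1 = i + 2 from rfl, show i + 1 + 2 = i + 3 from rfl,
      show ((i : ℝ) + 3) * 1 + 0 = i + 1 + 2 by ring, show ((i : ℝ) + 3) * 0 - 1 = -1 by ring,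
      show ((i : ℝ) + 3) * 0 + 1 = 1 by ring, show ((i : ℝ) + 3) * 1 - 0 = i + 1 + 2 by ring]
    ring

/-! ### The potential on the plane: smoothness, gradient, convexity, bounds -/

/-- `spiralPotential` as a function on the plane. -/
noncomputable def spiralFun (i : ℕ) (x : Plane) : ℝ := spiralPotential (i + 1) (x 0) (x 1)

theorem Plane.norm_sq (x : Plane) : ‖x‖ ^ 2 = x 0 ^ 2 + x 1 ^ 2 := by
  simp [EuclideanSpace.real_norm_sq_eq]

theorem Plane.sq_add_sq_pos {x : Plane} (hx : x ≠ 0) : 0 < x 0 ^ 2 + x 1 ^ 2 := by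
  rw [← Plane.norm_sq]
  have := norm_pos_iff.2 hx
  positivity

/-- The shift by one in `spiralFun` ensures C² even for `i = 0`, so that the gradient field is C¹
and the flow exists. -/
theorem contDiff_spiralFun (i : ℕ) : ContDiff ℝ (i + 2 : ℕ) (spiralFun i) := by
  have h0 : ContDiff ℝ (i + 2 : ℕ) (fun x : Plane ↦ x 0) := by fun_prop
  have h1 : ContDiff ℝ (i + 2 : ℕ) (fun x : Plane ↦ x 1) := by fun_prop
  have hs := (h0.pow 2).add (h1.pow 2)
  exact (hs.pow _).add (contDiff_const.mul ((((h0.pow 2).sub (h1.pow 2)).mul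
    ((contDiff_logOsc (i + 2) 1 0).comp hs)).sub (((contDiff_const.mul h0).mul h1).mul
    ((contDiff_logOsc (i + 2) 0 1).comp hs))))

theorem contDiffOn_spiralFun (i : ℕ) : ContDiffOn ℝ ∞ (spiralFun i) {0}ᶜ := by
  intro x hx
  refine ContDiffAt.contDiffWithinAt ?_
  have h0 : ContDiffAt ℝ ∞ (fun x : Plane ↦ x 0) x := by fun_prop
  have h1 : ContDiffAt ℝ ∞ (fun x : Plane ↦ x 1) x := by fun_prop
  have hs := (h0.pow 2).add (h1.pow 2)
  have hne : x 0 ^ 2 + x 1 ^ 2 ≠ 0 := (Plane.sq_add_sq_pos hx).ne'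
  exact (hs.pow _).add (contDiffAt_const.mul ((((h0.pow 2).sub (h1.pow 2)).mul
    ((contDiffAt_logOsc (i + 3) 1 0 hne).comp x hs)).sub (((contDiffAt_const.mul h0).mul h1).mul
    ((contDiffAt_logOsc (i + 3) 0 1 hne).comp x hs))))

theorem differentiable_spiralFun (i : ℕ) : Differentiable ℝ (spiralFun i) :=
  (contDiff_spiralFun i).differentiable (by norm_cast)

theorem hasGradientAt_spiralFun (i : ℕ) (x : Plane) :
    HasGradientAt (spiralFun i) !₂[spiralPotentialX (i + 1) (x 0) (x 1),
      spiralPotentialY (i + 1) (x 0) (x 1)] x := by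
  have hd := (differentiable_spiralFun i x).hasFDerivAt
  rw [hasGradientAt_iff_hasFDerivAt]
  refine hd.congr_fderiv (ContinuousLinearMap.ext fun v ↦ ?_)
  have hX : HasDerivAt (fun t : ℝ ↦ (x + t • v) 0) (v 0) 0 := by
    simpa using! ((hasDerivAt_id (0 : ℝ)).mul_const (v 0)).const_add (x 0)
  have hY : HasDerivAt (fun t : ℝ ↦ (x + t • v) 1) (v 1) 0 := by
    simpa using! ((hasDerivAt_id (0 : ℝ)).mul_const (v 1)).const_add (x 1)
  have h1 := hX.spiralPotential (i + 1) hY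
  have hl : HasDerivAt (fun t : ℝ ↦ x + t • v) v 0 := by
    simpa using! ((hasDerivAt_id (0 : ℝ)).smul_const v).const_add x
  have hd' : HasFDerivAt (spiralFun i) (fderiv ℝ (spiralFun i) x) (x + (0 : ℝ) • v) := by
    simpa using hd
  have h2 := hd'.comp_hasDerivAt 0 hl
  have := h1.unique h2
  rw [← this]
  simp [InnerProductSpace.toDual_apply_apply, PiLp.inner_apply, Fin.sum_univ_two]
  ring

theorem gradient_spiralFun (i : ℕ) (x : Plane) :
    ∇ (spiralFun i) x = !₂[spiralPotentialX (i + 1) (x 0) (x 1),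
      spiralPotentialY (i + 1) (x 0) (x 1)] :=
  (hasGradientAt_spiralFun i x).gradient

theorem contDiff_gradient_spiralFun (i : ℕ) : ContDiff ℝ 1 (∇ (spiralFun i)) := by
  have h : ContDiff ℝ 1 (fderiv ℝ (spiralFun i)) :=
    (contDiff_spiralFun i).fderiv_right (by norm_cast; omega)
  exact (InnerProductSpace.toDual ℝ Plane).symm.contDiff.comp h

theorem convexOn_spiralFun (i : ℕ) : ConvexOn ℝ univ (spiralFun i) := by
  refine ⟨convex_univ, fun x _ y _ a b ha hb hab ↦ ?_⟩
  let v := y - x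
  have hX (t : ℝ) : HasDerivAt (fun t : ℝ ↦ x 0 + t * v 0) (v 0) t := by
    simpa using! ((hasDerivAt_id t).mul_const (v 0)).const_add (x 0)
  have hY (t : ℝ) : HasDerivAt (fun t : ℝ ↦ x 1 + t * v 1) (v 1) t := by
    simpa using! ((hasDerivAt_id t).mul_const (v 1)).const_add (x 1)
  choose d hd0 hd using fun t ↦ exists_hasDerivAt_spiralPotential_line i (hX t) (hY t)
  have h1 := fun t ↦ (hX t).spiralPotential (i + 1) (hY t)
  have hc : ConvexOn ℝ univ (fun t : ℝ ↦ spiralPotential (i + 1) (x 0 + t * v 0) (x 1 + t * v 1)) :=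
    convexOn_of_hasDerivWithinAt2_nonneg convex_univ
      (continuousOn_of_forall_continuousAt fun t _ ↦ (h1 t).continuousAt)
      (fun t _ ↦ (h1 t).hasDerivWithinAt) (fun t _ ↦ (hd t).hasDerivWithinAt) (fun t _ ↦ hd0 t)
  have h := hc.2 (mem_univ 0) (mem_univ 1) ha hb hab
  have e : ∀ k, (a • x + b • y) k = x k + b * v k := by
    intro k
    simp only [v, PiLp.add_apply, PiLp.smul_apply, PiLp.sub_apply, smul_eq_mul]
    linear_combination (x k) * hab
  simp only [spiralFun, e]
  simpa [v] using h

theorem half_pow_le_spiralFun (i : ℕ) (x : Plane) :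
    (x 0 ^ 2 + x 1 ^ 2) ^ (i + 4) / 2 ≤ spiralFun i x := by
  rw [spiralFun, spiralPotential_eq]
  set s := x 0 ^ 2 + x 1 ^ 2 with hs
  have hs0 : 0 ≤ s := by positivity
  have hP := (abs_le.1 (abs_spiralRe_le (x 0) (x 1))).1
  rw [← hs] at hP
  have he : 1 / (20 * (((i + 1 : ℕ) : ℝ) + 3)) ≤ 1 / 2 := by
    gcongr
    push_cast
    linarith [i.cast_nonneg (α := ℝ)]
  have he0 : 0 ≤ 1 / (20 * (((i + 1 : ℕ) : ℝ) + 3)) := by positivity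
  have : s / 2 ≤ s + 1 / (20 * (((i + 1 : ℕ) : ℝ) + 3)) * spiralRe (x 0) (x 1) := by nlinarith
  calc s ^ (i + 4) / 2 = s ^ (i + 1 + 2) * (s / 2) := by ring
    _ ≤ _ := by gcongr

@[simp]
theorem spiralFun_zero (i : ℕ) : spiralFun i 0 = 0 := by
  simp [spiralFun, spiralPotential]

theorem spiralFun_pos (i : ℕ) {x : Plane} (hx : x ≠ 0) : 0 < spiralFun i x := by
  have := Plane.sq_add_sq_pos hx
  exact lt_of_lt_of_le (by positivity) (half_pow_le_spiralFun i x)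

/-- The radial derivative of `spiralFun` is comparable to `|x| ^ (2 * i + 8)`. -/
theorem inner_gradient_spiralFun_bounds (i : ℕ) (x : Plane) :
    (x 0 ^ 2 + x 1 ^ 2) ^ (i + 4) ≤ inner ℝ x (∇ (spiralFun i) x) ∧
      inner ℝ x (∇ (spiralFun i) x) ≤ 4 * (i + 4) * (x 0 ^ 2 + x 1 ^ 2) ^ (i + 4) := by
  have e : inner ℝ x (∇ (spiralFun i) x) = x 0 * spiralPotentialX (i + 1) (x 0) (x 1) +
      x 1 * spiralPotentialY (i + 1) (x 0) (x 1) := by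
    simp [gradient_spiralFun, PiLp.inner_apply, Fin.sum_univ_two]
    ring
  rw [e, radial_spiralPotential]
  push_cast
  rw [show (i : ℝ) + 1 + 3 = i + 4 by ring]
  set s := x 0 ^ 2 + x 1 ^ 2 with hs
  have hs0 : 0 ≤ s := by positivity
  have hi : (0 : ℝ) ≤ i := i.cast_nonneg
  have hb : |1 / (20 * ((i : ℝ) + 4)) * ((i + 4) * spiralRe (x 0) (x 1) - spiralIm (x 0) (x 1))| ≤
      s := by
    -- The bracket is at most (i + 5) s, well below 20 (i + 4) s, so ε makes the perturbation at
    -- most s.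
    rw [abs_mul, abs_of_nonneg (by positivity)]
    have h1 : |((i : ℝ) + 4) * spiralRe (x 0) (x 1) - spiralIm (x 0) (x 1)| ≤
        20 * ((i : ℝ) + 4) * s := by
      refine (abs_sub _ _).trans ?_
      rw [abs_mul, abs_of_nonneg (by positivity : (0 : ℝ) ≤ i + 4)]
      have := abs_spiralRe_le (x 0) (x 1)
      have := abs_spiralIm_le (x 0) (x 1)
      nlinarith
    calc _ ≤ 1 / (20 * ((i : ℝ) + 4)) * (20 * ((i : ℝ) + 4) * s) := by gcongr
      _ = s := by field_simp
  obtain ⟨h1, h2⟩ := abs_le.1 hb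
  constructor
  · calc s ^ (i + 4) = s ^ (i + 1 + 2) * s := by ring
      _ ≤ 2 * s ^ (i + 1 + 2) * (s / 2) := by linarith
      _ ≤ _ := by
        gcongr
        nlinarith
  · calc _ ≤ 2 * s ^ (i + 1 + 2) * (2 * (i + 4) * s) := by
          gcongr
          nlinarith
      _ = _ := by ring

theorem exists_isGradientTrajectory_spiralFun (i : ℕ) (x₀ : Plane) :
    ∃ γ, IsGradientTrajectory (spiralFun i) x₀ γ := by
  obtain ⟨γ, h0, hγ⟩ := exists_forward_integralCurve (contDiff_gradient_spiralFun i).neg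
    (fun x ↦ by
      rw [inner_neg_right, neg_nonpos]
      exact le_trans (by positivity) (inner_gradient_spiralFun_bounds i x).1) x₀
  exact ⟨γ, h0, hγ⟩

/-! ### Spiralling excludes a limiting secant -/

/-- A curve that turns infinitely many times around a point has no limiting secant there. -/
theorem SpiralsAround.not_secantsConverge {γ : ℝ → Plane} {p : Plane} (h : SpiralsAround γ p) :
    ¬ SecantsConverge γ p := by
  rintro ⟨d, hd⟩
  obtain ⟨hne, θ, hθc, hθ, hlim⟩ := h
  have hcos : ∀ t, 0 ≤ t → (‖γ t - p‖⁻¹ • (γ t - p)) 0 = Real.cos |θ t| := by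
    intro t ht
    have hn : ‖γ t - p‖ ≠ 0 := norm_ne_zero_iff.2 (sub_ne_zero.2 (hne t ht))
    have h1 : γ t - p = ‖γ t - p‖ • !₂[Real.cos (θ t), Real.sin (θ t)] :=
      sub_eq_iff_eq_add'.2 (hθ t ht)
    rw [Real.cos_abs]
    conv_lhs => rw [h1, norm_smul, norm_norm]
    have h2 : ‖(!₂[Real.cos (θ t), Real.sin (θ t)] : Plane)‖ = 1 := by
      simp [EuclideanSpace.norm_eq, Fin.sum_univ_two]
    rw [h2, mul_one, smul_smul, inv_mul_cancel₀ hn]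
    simp
  have hd0 : Tendsto (fun t ↦ Real.cos |θ t|) atTop (𝓝 (d 0)) := by
    have h0 : Tendsto (fun t ↦ (‖γ t - p‖⁻¹ • (γ t - p)) 0) atTop (𝓝 (d 0)) :=
      ((EuclideanSpace.proj (𝕜 := ℝ) (0 : Fin 2)).continuous.tendsto d).comp hd
    refine h0.congr' ?_
    filter_upwards [eventually_ge_atTop 0] with t ht using hcos t ht
  -- By the intermediate value theorem `|θ|` passes through c + 2πn for all large n, so the first
  -- coordinate of the secant takes the value cos c at arbitrarily late times.
  have hsurj : ∀ c : ℝ, ∃ᶠ t in atTop, Real.cos |θ t| = Real.cos c := by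
    intro c
    rw [frequently_atTop]
    intro a
    obtain ⟨n, hn⟩ := exists_nat_gt ((|θ (max a 0)| - c) / (2 * Real.pi))
    rw [div_lt_iff₀ (by positivity)] at hn
    obtain ⟨b, hb1, hb2⟩ := ((hlim.eventually_ge_atTop (c + n * (2 * Real.pi))).and
      (eventually_ge_atTop (max a 0))).exists
    have hc : ContinuousOn (fun t ↦ |θ t|) (Icc (max a 0) b) :=
      (hθc.mono fun t ht ↦ (le_max_right a 0).trans ht.1).abs
    obtain ⟨t, ht, hte⟩ := intermediate_value_Icc hb2 hc
      (show c + n * (2 * Real.pi) ∈ Icc _ _ from ⟨by linarith, hb1⟩)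
    refine ⟨t, (le_max_left a 0).trans ht.1, ?_⟩
    rw [show |θ t| = c + n * (2 * Real.pi) from hte, Real.cos_add_nat_mul_two_pi]
  have hval : ∀ c : ℝ, d 0 = Real.cos c := by
    intro c
    by_contra hc
    exact hsurj c ((hd0.eventually_ne hc).mono fun t ht ↦ ht)
  have h1 := (hval 0).symm.trans (hval Real.pi)
  norm_num at h1

/-! ### Second-order drift of the angle -/

/-- The averaging argument: the slow drift of the angle `θ` along a trajectory. -/
theorem tendsto_angle_atTop {θ L w : ℝ → ℝ} {J e : ℝ} (hJ : 1 ≤ J) (he : 0 < e) (he' : e ≤ 1 / 4)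
    (hw : ∀ t, 0 < t → 0 ≤ w t) (hθc : ContinuousOn θ (Ici 0)) (hLc : ContinuousOn L (Ici 0))
    (hθ : ∀ t, 0 < t → HasDerivAt θ (2 * e * w t * Real.sin (2 * θ t + L t)) t)
    (hL : ∀ t, 0 < t → HasDerivAt L (-(4 * w t * (J + e * (J * Real.cos (2 * θ t + L t) -
      Real.sin (2 * θ t + L t))))) t)
    (hlim : Tendsto L atTop atBot) : Tendsto θ atTop atTop := by
  -- The largest `k` for which the crude bound 8kJw on the loss rate is still covered by the drift
  -- rate 2e²w/J (both multiplying sin² φ).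
  set k := e ^ 2 / (4 * J ^ 2) with hk
  have hJ0 : 0 < J := by linarith
  have hk0 : 0 < k := by positivity
  have hg : ∀ x, 1 / 2 ≤ 1 + e * Real.cos x := fun x ↦ by nlinarith [Real.neg_one_le_cos x]
  have hg2 : ∀ x, 1 + e * Real.cos x ≤ 2 := fun x ↦ by nlinarith [Real.cos_le_one x]
  let φ : ℝ → ℝ := fun t ↦ 2 * θ t + L t
  have hφc : ContinuousOn φ (Ici 0) := (continuousOn_const.mul hθc).add hLc
  -- The logarithm cancels the first-order oscillation of θ. The last term is k times an
  -- antiderivative of sin² φ in the phase: it grows linearly in φ, and so brings L into the final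
  -- bound, while its derivative is absorbed by the drift.
  let Ψ : ℝ → ℝ := fun t ↦ θ t - 1 / (2 * J) * Real.log (1 + e * Real.cos (φ t)) +
    k * (φ t / 2 - Real.sin (φ t) * Real.cos (φ t) / 2)
  have hΨd : ∀ t, 0 < t → ∃ d, 0 ≤ d ∧ HasDerivAt Ψ d t := by
    intro t ht
    have hφ : HasDerivAt φ (-(4 * w t * (J * (1 + e * Real.cos (φ t)) - 2 * e * Real.sin (φ t)))) t :=
      (((hθ t ht).const_mul 2).fun_add (hL t ht)).congr_deriv (by simp only [φ]; ring)
    have hgp : 0 < 1 + e * Real.cos (φ t) := by linarith [hg (φ t)]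
    have h := ((hθ t ht).fun_sub ((((hφ.cos.const_mul e).const_add 1).log hgp.ne').const_mul
      (1 / (2 * J)))).fun_add (((hφ.div_const 2).fun_sub
        ((hφ.sin.fun_mul hφ.cos).div_const 2)).const_mul k)
    refine ⟨_, ?_, h⟩
    change 0 ≤ 2 * e * w t * Real.sin (φ t) - _ + _
    set c := Real.cos (φ t) with hc
    set s := Real.sin (φ t) with hs
    have hsc : c ^ 2 = 1 - s ^ 2 := by rw [hs, hc]; exact Real.cos_sq' _
    have hw0 := hw t ht
    have key : 2 * e * w t * s - 1 / (2 * J) * (e * (-s * -(4 * w t * (J * (1 + e * c) - 2 * e * s)))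
        / (1 + e * c)) = 4 * e ^ 2 * w t / J * s ^ 2 / (1 + e * c) := by
      field_simp
      ring
    rw [key]
    have h1 : 2 * e ^ 2 * w t / J * s ^ 2 ≤ 4 * e ^ 2 * w t / J * s ^ 2 / (1 + e * c) := by
      rw [le_div_iff₀ hgp]
      have : 0 ≤ 2 * e ^ 2 * w t / J * s ^ 2 := by positivity
      calc _ ≤ 2 * e ^ 2 * w t / J * s ^ 2 * 2 := by gcongr; exact hg2 _
        _ = _ := by ring
    have h2 : k * (-(4 * w t * (J * (1 + e * c) - 2 * e * s)) / 2 -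
        (c * -(4 * w t * (J * (1 + e * c) - 2 * e * s)) * c +
          s * (-s * -(4 * w t * (J * (1 + e * c) - 2 * e * s)))) / 2) =
        -(k * (4 * w t * (J * (1 + e * c) - 2 * e * s)) * s ^ 2) := by
      linear_combination (k * (4 * w t * (J * (1 + e * c) - 2 * e * s)) / 2) * hsc
    rw [h2]
    have h3 : k * (4 * w t * (J * (1 + e * c) - 2 * e * s)) * s ^ 2 ≤ 2 * e ^ 2 * w t / J * s ^ 2 := by
      have : J * (1 + e * c) - 2 * e * s ≤ 2 * J := by
        have := Real.cos_le_one (φ t)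
        have := Real.neg_one_le_sin (φ t)
        have : e * c ≤ e := by nlinarith
        have : -(e * s) ≤ e := by nlinarith
        nlinarith
      calc _ ≤ k * (4 * w t * (2 * J)) * s ^ 2 := by gcongr
        _ = _ := by rw [hk]; field_simp
    linarith
  have hmono : MonotoneOn Ψ (Ici 0) := by
    refine monotoneOn_of_deriv_nonneg (convex_Ici 0) ?_ ?_ ?_
    · refine (hθc.sub (continuousOn_const.mul (ContinuousOn.log (continuousOn_const.add
        (continuousOn_const.mul (Real.continuous_cos.comp_continuousOn hφc))) fun t _ ↦ ?_))).add
        (continuousOn_const.mul ((hφc.div_const 2).sub (((Real.continuous_sin.comp_continuousOn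
        hφc).mul (Real.continuous_cos.comp_continuousOn hφc)).div_const 2)))
      exact (lt_of_lt_of_le (by norm_num) (hg (φ t))).ne'
    · rw [interior_Ici]
      intro t ht
      obtain ⟨d, -, hd⟩ := hΨd t ht
      exact hd.differentiableAt.differentiableWithinAt
    · rw [interior_Ici]
      intro t ht
      obtain ⟨d, hd0, hd⟩ := hΨd t ht
      rwa [hd.deriv]
  -- In Ψ(t) ≥ Ψ(0) the logarithm and sin φ cos φ are bounded, and φ/2 = θ + L/2; solving for θ
  -- leaves a negative multiple of L.
  have hbound : ∀ᶠ t in atTop, (Ψ 0 - 1 - k / 2) / (1 + k) + -(k / 2 / (1 + k)) * L t ≤ θ t := by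
    filter_upwards [eventually_ge_atTop 0] with t ht
    have h := hmono (mem_Ici.2 le_rfl) (mem_Ici.2 ht) ht
    have hlog1 : -1 ≤ Real.log (1 + e * Real.cos (φ t)) := by
      have := Real.one_sub_inv_le_log_of_pos (by linarith [hg (φ t)] : 0 < 1 + e * Real.cos (φ t))
      have h2 : (1 + e * Real.cos (φ t))⁻¹ ≤ (1 / 2)⁻¹ := inv_anti₀ (by norm_num) (hg _)
      norm_num at h2
      linarith
    have hlog2 : -1 ≤ 1 / (2 * J) * Real.log (1 + e * Real.cos (φ t)) := by
      have h3 : 1 / (2 * J) ≤ 1 := by rw [div_le_one (by positivity)]; linarith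
      have h4 : 0 < 1 / (2 * J) := by positivity
      nlinarith
    have hsc : Real.sin (φ t) * Real.cos (φ t) / 2 ≤ 1 / 2 := by
      nlinarith [Real.sin_sq_add_cos_sq (φ t), sq_nonneg (Real.sin (φ t) - Real.cos (φ t))]
    have hΨ : Ψ t = θ t - 1 / (2 * J) * Real.log (1 + e * Real.cos (φ t)) +
      k * ((2 * θ t + L t) / 2 - Real.sin (φ t) * Real.cos (φ t) / 2) := rfl
    rw [show (Ψ 0 - 1 - k / 2) / (1 + k) + -(k / 2 / (1 + k)) * L t =
      (Ψ 0 - 1 - k / 2 - k / 2 * L t) / (1 + k) by ring, div_le_iff₀ (by positivity)]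
    nlinarith [mul_le_mul_of_nonneg_left hsc hk0.le, Real.sin_sq_add_cos_sq (φ t),
      mul_nonneg hk0.le (sq_nonneg (Real.sin (φ t) + Real.cos (φ t)))]
  refine tendsto_atTop_mono' _ hbound (tendsto_atTop_add_const_left _ _ ?_)
  exact hlim.const_mul_atBot_of_neg (neg_neg_of_pos (by positivity))

/-! ### Gradient trajectories: convergence, polar angle, spiralling -/

theorem Plane.exists_polar (x : Plane) :
    ∃ θ : ℝ, x = ‖x‖ • !₂[Real.cos θ, Real.sin θ] := by
  let z : ℂ := ⟨x 0, x 1⟩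
  have hz : ‖z‖ = ‖x‖ := by
    rw [← sq_eq_sq₀ (norm_nonneg _) (norm_nonneg _), Plane.norm_sq, Complex.sq_norm,
      Complex.normSq_apply]
    ring
  refine ⟨z.arg, ?_⟩
  ext k
  fin_cases k
  · simpa [z, hz] using (Complex.norm_mul_cos_arg z).symm
  · simpa [z, hz] using (Complex.norm_mul_sin_arg z).symm

theorem HasDerivWithinAt.plane_apply {γ : ℝ → Plane} {γ' : Plane} {s : Set ℝ} {t : ℝ}
    (h : HasDerivWithinAt γ γ' s t) (k : Fin 2) :
    HasDerivWithinAt (fun t ↦ γ t k) (γ' k) s t :=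
  (EuclideanSpace.proj (𝕜 := ℝ) k).hasFDerivAt.comp_hasDerivWithinAt t h

namespace IsGradientTrajectory

variable {i : ℕ} {x₀ : Plane} {γ : ℝ → Plane}

theorem continuousOn {f : Plane → ℝ} (h : IsGradientTrajectory f x₀ γ) : ContinuousOn γ (Ici 0) :=
  fun t ht ↦ (h.hasDeriv t ht).continuousWithinAt

theorem hasDerivWithinAt_normSq {f : Plane → ℝ} (h : IsGradientTrajectory f x₀ γ) {t : ℝ}
    (ht : 0 ≤ t) :
    HasDerivWithinAt (fun t ↦ γ t 0 ^ 2 + γ t 1 ^ 2) (-(2 * inner ℝ (γ t) (∇ f (γ t)))) (Ici 0) t := by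
  have := (h.hasDeriv t ht).norm_sq
  rw [inner_neg_right, mul_neg] at this
  simpa only [Plane.norm_sq] using this

theorem antitoneOn_normSq (h : IsGradientTrajectory (spiralFun i) x₀ γ) :
    AntitoneOn (fun t ↦ γ t 0 ^ 2 + γ t 1 ^ 2) (Ici 0) := by
  refine antitoneOn_of_hasDerivWithinAt_nonpos (convex_Ici 0)
    (fun t ht ↦ (h.hasDerivWithinAt_normSq ht).continuousWithinAt)
    (fun t ht ↦ (h.hasDerivWithinAt_normSq (interior_subset ht)).mono interior_subset)
    fun t _ ↦ ?_
  have : (0 : ℝ) ≤ inner ℝ (γ t) (∇ (spiralFun i) (γ t)) :=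
    le_trans (by positivity) (inner_gradient_spiralFun_bounds i (γ t)).1
  linarith

/-- By the upper radial bound, S = |γ|² satisfies S' ≥ -cS with c determined by S(0), so S decays at
most exponentially and cannot vanish in finite time. -/
theorem normSq_pos (h : IsGradientTrajectory (spiralFun i) x₀ γ) (hx₀ : x₀ ≠ 0) {t : ℝ}
    (ht : 0 ≤ t) : 0 < γ t 0 ^ 2 + γ t 1 ^ 2 := by
  set S : ℝ → ℝ := fun t ↦ γ t 0 ^ 2 + γ t 1 ^ 2 with hS
  have hS0 : 0 < S 0 := by simpa [hS, h.initial] using Plane.sq_add_sq_pos hx₀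
  set c : ℝ := 8 * (i + 4) * S 0 ^ (i + 3) with hc
  have hd : ∀ t, 0 ≤ t → HasDerivWithinAt (fun t ↦ S t * Real.exp (c * t))
      (-(2 * inner ℝ (γ t) (∇ (spiralFun i) (γ t))) * Real.exp (c * t) +
        S t * (Real.exp (c * t) * c)) (Ici 0) t := fun t ht ↦ by
    have h1 : HasDerivAt (fun t ↦ Real.exp (c * t)) (Real.exp (c * t) * c) t := by
      simpa using ((hasDerivAt_id t).const_mul c).exp
    exact (h.hasDerivWithinAt_normSq ht).mul h1.hasDerivWithinAt
  have hmono : MonotoneOn (fun t ↦ S t * Real.exp (c * t)) (Ici 0) := by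
    refine monotoneOn_of_hasDerivWithinAt_nonneg (convex_Ici 0)
      (fun t ht ↦ (hd t ht).continuousWithinAt)
      (fun t ht ↦ (hd t (interior_subset ht)).mono interior_subset) fun t ht ↦ ?_
    have hle : S t ≤ S 0 := h.antitoneOn_normSq (mem_Ici.2 le_rfl) (interior_subset ht)
      (interior_subset ht)
    have hn : 0 ≤ S t := by positivity
    have h1 : inner ℝ (γ t) (∇ (spiralFun i) (γ t)) ≤ 4 * (i + 4) * S t ^ (i + 4) :=
      (inner_gradient_spiralFun_bounds i (γ t)).2
    have h2 : 4 * ((i : ℝ) + 4) * S t ^ (i + 4) ≤ 4 * (i + 4) * (S 0 ^ (i + 3) * S t) := by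
      rw [pow_succ]
      gcongr
    have h3 : 0 ≤ S t * c - 2 * inner ℝ (γ t) (∇ (spiralFun i) (γ t)) := by
      rw [hc]
      linarith
    calc 0 ≤ (S t * c - 2 * inner ℝ (γ t) (∇ (spiralFun i) (γ t))) * Real.exp (c * t) := by
          positivity
      _ = _ := by ring
  have := hmono (mem_Ici.2 le_rfl) (mem_Ici.2 ht) ht
  simp only [mul_zero, Real.exp_zero, mul_one] at this
  exact pos_of_mul_pos_left (hS0.trans_le this) (Real.exp_pos _).le

theorem tendsto_normSq (h : IsGradientTrajectory (spiralFun i) x₀ γ) :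
    Tendsto (fun t ↦ γ t 0 ^ 2 + γ t 1 ^ 2) atTop (𝓝 0) := by
  set S : ℝ → ℝ := fun t ↦ γ t 0 ^ 2 + γ t 1 ^ 2 with hS
  have hn : ∀ t, 0 ≤ S t := fun t ↦ by positivity
  rw [Metric.tendsto_atTop]
  intro δ hδ
  obtain ⟨T, hT0, hT⟩ : ∃ T, 0 ≤ T ∧ S T < δ := by
    -- If S stayed above δ, the lower radial bound would make it decrease at rate at least 2δ^(i+4),
    -- exhausting S(0) in finite time.
    by_contra! hcon
    have hanti : AntitoneOn (fun t ↦ S t + 2 * δ ^ (i + 4) * t) (Ici 0) := by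
      refine antitoneOn_of_hasDerivWithinAt_nonpos (convex_Ici 0)
        (f' := fun t ↦ -(2 * inner ℝ (γ t) (∇ (spiralFun i) (γ t))) + 2 * δ ^ (i + 4)) ?_ ?_ ?_
      · exact fun t ht ↦ (h.hasDerivWithinAt_normSq ht).continuousWithinAt.add (by fun_prop)
      · intro t ht
        have h1 : HasDerivAt (fun t ↦ 2 * δ ^ (i + 4) * t) (2 * δ ^ (i + 4)) t := by
          simpa using (hasDerivAt_id t).const_mul (2 * δ ^ (i + 4))
        exact ((h.hasDerivWithinAt_normSq (interior_subset ht)).mono interior_subset).add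
          h1.hasDerivWithinAt
      · intro t ht
        have h1 : S t ^ (i + 4) ≤ _ := (inner_gradient_spiralFun_bounds i (γ t)).1
        have h2 : δ ^ (i + 4) ≤ S t ^ (i + 4) :=
          pow_le_pow_left₀ hδ.le (hcon t (interior_subset ht)) _
        linarith
    have hT : 0 ≤ S 0 / (2 * δ ^ (i + 4)) := div_nonneg (hn 0) (by positivity)
    have h1 := hanti (mem_Ici.2 le_rfl) (mem_Ici.2 hT) hT
    have h2 := hcon _ hT
    simp only [mul_zero, add_zero] at h1
    rw [mul_div_cancel₀ _ (by positivity)] at h1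
    linarith
  refine ⟨T, fun t ht ↦ ?_⟩
  rw [Real.dist_eq, sub_zero, abs_of_nonneg (hn t)]
  exact (h.antitoneOn_normSq (mem_Ici.2 hT0) (mem_Ici.2 (hT0.trans ht)) ht).trans_lt hT

theorem tendsto_zero (h : IsGradientTrajectory (spiralFun i) x₀ γ) : Tendsto γ atTop (𝓝 0) := by
  rw [tendsto_zero_iff_norm_tendsto_zero]
  have := h.tendsto_normSq.sqrt
  simpa only [← Plane.norm_sq, Real.sqrt_sq (norm_nonneg _), Real.sqrt_zero] using this

theorem hasDerivWithinAt_fst (h : IsGradientTrajectory (spiralFun i) x₀ γ) {t : ℝ} (ht : 0 ≤ t) :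
    HasDerivWithinAt (fun t ↦ γ t 0) (-spiralPotentialX (i + 1) (γ t 0) (γ t 1)) (Ici 0) t := by
  simpa [gradient_spiralFun] using (h.hasDeriv t ht).plane_apply 0

theorem hasDerivWithinAt_snd (h : IsGradientTrajectory (spiralFun i) x₀ γ) {t : ℝ} (ht : 0 ≤ t) :
    HasDerivWithinAt (fun t ↦ γ t 1) (-spiralPotentialY (i + 1) (γ t 0) (γ t 1)) (Ici 0) t := by
  simpa [gradient_spiralFun] using (h.hasDeriv t ht).plane_apply 1

/-- The angular velocity of a trajectory integrates to a continuous polar angle. -/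
theorem exists_angle (h : IsGradientTrajectory (spiralFun i) x₀ γ) (hx₀ : x₀ ≠ 0) :
    ∃ θ : ℝ → ℝ, Continuous θ ∧
      (∀ t, 0 ≤ t → HasDerivAt θ (2 * (1 / (20 * ((i : ℝ) + 4))) *
        (γ t 0 ^ 2 + γ t 1 ^ 2) ^ (i + 2) * spiralIm (γ t 0) (γ t 1)) t) ∧
      ∀ t, 0 ≤ t → γ t = ‖γ t‖ • !₂[Real.cos (θ t), Real.sin (θ t)] := by
  obtain ⟨θ₀, hθ₀⟩ := x₀.exists_polar
  set e : ℝ := 1 / (20 * ((i : ℝ) + 4)) with he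
  let v : ℝ → ℝ := fun t ↦ 2 * e * (γ t 0 ^ 2 + γ t 1 ^ 2) ^ (i + 2) * spiralIm (γ t 0) (γ t 1)
  have hcγ (k : Fin 2) : ContinuousOn (fun t ↦ γ t k) (Ici 0) := fun t ht ↦
    ((h.hasDeriv t ht).plane_apply k).continuousWithinAt
  have hcS : ContinuousOn (fun t ↦ γ t 0 ^ 2 + γ t 1 ^ 2) (Ici 0) :=
    ((hcγ 0).pow 2).add ((hcγ 1).pow 2)
  have hcL : ContinuousOn (fun t ↦ Real.log (γ t 0 ^ 2 + γ t 1 ^ 2)) (Ici 0) :=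
    hcS.log fun t ht ↦ (h.normSq_pos hx₀ ht).ne'
  have hcv : ContinuousOn v (Ici 0) :=
    (continuousOn_const.mul (hcS.pow _)).mul ((((hcγ 0).pow 2).sub ((hcγ 1).pow 2)).mul
      (Real.continuous_sin.comp_continuousOn hcL) |>.add (((continuousOn_const.mul (hcγ 0)).mul
        (hcγ 1)).mul (Real.continuous_cos.comp_continuousOn hcL)))
  have hcv' : Continuous fun t ↦ v (max t 0) :=
    hcv.comp_continuous (by fun_prop) fun t ↦ le_max_right t 0
  -- Clamping time at 0 makes the integrand continuous on the whole line, so θ has a two-sided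
  -- derivative even at 0.
  let θ : ℝ → ℝ := fun t ↦ θ₀ + ∫ τ in (0 : ℝ)..t, v (max τ 0)
  have hθ' (t : ℝ) : HasDerivAt θ (v (max t 0)) t :=
    (hcv'.integral_hasStrictDerivAt 0 t).hasDerivAt.const_add θ₀
  have hθ : ∀ t, 0 ≤ t → HasDerivAt θ (v t) t := fun t ht ↦ by
    simpa [max_eq_left ht] using hθ' t
  refine ⟨θ, continuous_iff_continuousAt.2 fun t ↦ (hθ' t).continuousAt, hθ, ?_⟩
  -- W is the cosine of the angle between γ and the direction θ. It is constant because θ turns at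
  -- the angular speed of γ, and it starts at 1.
  let W : ℝ → ℝ := fun t ↦ (γ t 0 * Real.cos (θ t) + γ t 1 * Real.sin (θ t)) /
    Real.sqrt (γ t 0 ^ 2 + γ t 1 ^ 2)
  have hW : ∀ t, 0 ≤ t → HasDerivWithinAt W 0 (Ici 0) t := by
    intro t ht
    have hS := h.normSq_pos hx₀ ht
    have hθt := (hθ t ht).hasDerivWithinAt (s := Ici 0)
    have hX := h.hasDerivWithinAt_fst ht
    have hY := h.hasDerivWithinAt_snd ht
    have hd := ((hX.mul hθt.cos).add (hY.mul hθt.sin)).div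
      (((hX.fun_pow 2).fun_add (hY.fun_pow 2)).sqrt hS.ne') (Real.sqrt_ne_zero'.2 hS)
    refine hd.congr_deriv ?_
    have hang := angular_spiralPotential (i + 1) (γ t 0) (γ t 1)
    push_cast at hang
    rw [show (i : ℝ) + 1 + 3 = i + 4 by ring, ← he] at hang
    have hv : v t * (γ t 0 ^ 2 + γ t 1 ^ 2) = -(γ t 0 * spiralPotentialY (i + 1) (γ t 0) (γ t 1) -
        γ t 1 * spiralPotentialX (i + 1) (γ t 0) (γ t 1)) := by
      rw [hang]
      simp only [v]
      ring
    simp only [Pi.add_apply, Pi.mul_apply]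
    rw [div_eq_zero_iff]
    left
    have hsq := Real.sq_sqrt hS.le
    have hr : Real.sqrt (γ t 0 ^ 2 + γ t 1 ^ 2) ≠ 0 := Real.sqrt_ne_zero'.2 hS
    set X := γ t 0
    set Y := γ t 1
    set r := Real.sqrt (X ^ 2 + Y ^ 2)
    set GX := spiralPotentialX (i + 1) X Y
    set GY := spiralPotentialY (i + 1) X Y
    field_simp
    rw [hsq]
    push_cast
    linear_combination 2 * (-X * Real.sin (θ t) + Y * Real.cos (θ t)) * hv
  have hW1 : ∀ t, 0 ≤ t → W t = 1 := by
    intro t ht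
    have hconst := constant_of_has_deriv_right_zero (a := 0) (b := t) (f := W)
      (fun u hu ↦ ((hW u hu.1).continuousWithinAt).mono Icc_subset_Ici_self)
      (fun u hu ↦ (hW u hu.1).mono (Ici_subset_Ici.2 hu.1)) t ⟨ht, le_rfl⟩
    rw [hconst]
    have hr : ‖x₀‖ ≠ 0 := norm_ne_zero_iff.2 hx₀
    have hθ0 : θ 0 = θ₀ := by simp [θ]
    have h0 : x₀ 0 = ‖x₀‖ * Real.cos θ₀ := by simpa using congrArg (fun z : Plane ↦ z 0) hθ₀
    have h1 : x₀ 1 = ‖x₀‖ * Real.sin θ₀ := by simpa using congrArg (fun z : Plane ↦ z 1) hθ₀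
    simp only [W, h.initial, hθ0]
    rw [← Plane.norm_sq, Real.sqrt_sq (norm_nonneg _), div_eq_one_iff_eq hr]
    linear_combination Real.cos θ₀ * h0 + Real.sin θ₀ * h1 +
      ‖x₀‖ * Real.sin_sq_add_cos_sq θ₀
  intro t ht
  have hS := h.normSq_pos hx₀ ht
  have h1 := hW1 t ht
  have hn := Plane.norm_sq (γ t)
  simp only [W] at h1
  rw [div_eq_one_iff_eq (Real.sqrt_ne_zero'.2 hS), ← hn, Real.sqrt_sq (norm_nonneg _)] at h1
  -- Equality case of Cauchy–Schwarz: cosine 1 forces γ to be `‖γ‖` times the unit vector.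
  have hz : (γ t 0 - ‖γ t‖ * Real.cos (θ t)) ^ 2 + (γ t 1 - ‖γ t‖ * Real.sin (θ t)) ^ 2 = 0 := by
    linear_combination (-1 : ℝ) * hn - 2 * ‖γ t‖ * h1 +
      ‖γ t‖ ^ 2 * Real.sin_sq_add_cos_sq (θ t)
  have hz0 : γ t 0 - ‖γ t‖ * Real.cos (θ t) = 0 := by
    nlinarith [sq_nonneg (γ t 1 - ‖γ t‖ * Real.sin (θ t)),
      sq_nonneg (γ t 0 - ‖γ t‖ * Real.cos (θ t))]
  have hz1 : γ t 1 - ‖γ t‖ * Real.sin (θ t) = 0 := by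
    rw [hz0] at hz
    simpa using hz
  ext k
  fin_cases k
  · simpa using sub_eq_zero.1 hz0
  · simpa using sub_eq_zero.1 hz1

theorem spiralsAround (h : IsGradientTrajectory (spiralFun i) x₀ γ) (hx₀ : x₀ ≠ 0) :
    SpiralsAround γ 0 := by
  obtain ⟨θ, hθc, hθ, hpol⟩ := h.exists_angle hx₀
  refine ⟨fun t ht h0 ↦ ?_, θ, hθc.continuousOn, fun t ht ↦ by simpa using hpol t ht, ?_⟩
  · have := h.normSq_pos hx₀ ht
    simp [h0] at this
  have hi : (0 : ℝ) ≤ i := i.cast_nonneg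
  set e : ℝ := 1 / (20 * ((i : ℝ) + 4)) with he
  have he0 : 0 < e := by positivity
  have he1 : e ≤ 1 / 4 := by
    rw [he]
    gcongr
    linarith
  set S : ℝ → ℝ := fun t ↦ γ t 0 ^ 2 + γ t 1 ^ 2 with hS
  have hpos : ∀ t, 0 ≤ t → 0 < S t := fun t ht ↦ h.normSq_pos hx₀ ht
  have hXY : ∀ t, 0 ≤ t → spiralRe (γ t 0) (γ t 1) = S t * Real.cos (2 * θ t + Real.log (S t)) ∧
      spiralIm (γ t 0) (γ t 1) = S t * Real.sin (2 * θ t + Real.log (S t)) := by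
    intro t ht
    have h0 : γ t 0 = ‖γ t‖ * Real.cos (θ t) := by
      simpa using congrArg (fun z : Plane ↦ z 0) (hpol t ht)
    have h1 : γ t 1 = ‖γ t‖ * Real.sin (θ t) := by
      simpa using congrArg (fun z : Plane ↦ z 1) (hpol t ht)
    have hn : ‖γ t‖ ^ 2 = S t := Plane.norm_sq (γ t)
    have hA : γ t 0 ^ 2 - γ t 1 ^ 2 = S t * Real.cos (2 * θ t) := by
      rw [h0, h1, ← hn, Real.cos_two_mul']
      ring
    have hB : 2 * γ t 0 * γ t 1 = S t * Real.sin (2 * θ t) := by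
      rw [h0, h1, ← hn, Real.sin_two_mul]
      ring
    have hS' : γ t 0 ^ 2 + γ t 1 ^ 2 = S t := rfl
    rw [spiralRe, spiralIm, hA, hB, hS', Real.cos_add, Real.sin_add]
    constructor <;> ring
  have hdS : ∀ t, 0 < t → HasDerivAt S (-(2 * inner ℝ (γ t) (∇ (spiralFun i) (γ t)))) t :=
    fun t ht ↦ (h.hasDerivWithinAt_normSq ht.le).hasDerivAt (Ici_mem_nhds ht)
  have hlim : Tendsto (fun t ↦ Real.log (S t)) atTop atBot := by
    refine Real.tendsto_log_nhdsGT_zero.comp (tendsto_nhdsWithin_iff.2 ⟨h.tendsto_normSq, ?_⟩)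
    filter_upwards [eventually_ge_atTop 0] with t ht using hpos t ht
  -- Here L = log |γ|² and 2θ + L is the phase of the potential at γ; the exponent J is i + 4.
  refine tendsto_abs_atTop_atTop.comp (tendsto_angle_atTop (L := fun t ↦ Real.log (S t))
    (w := fun t ↦ S t ^ (i + 3)) (J := i + 4) (e := e) (by linarith) he0 he1
    (fun t ht ↦ (pow_pos (hpos t ht.le) _).le) hθc.continuousOn
    (ContinuousOn.log (fun t ht ↦ (h.hasDerivWithinAt_normSq ht).continuousWithinAt)
      fun t ht ↦ (hpos t ht).ne') (fun t ht ↦ ?_) (fun t ht ↦ ?_) hlim)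
  · refine (hθ t ht.le).congr_deriv ?_
    rw [(hXY t ht.le).2]
    simp only [hS]
    ring
  · refine ((hdS t ht).log (hpos t ht.le).ne').congr_deriv ?_
    have hin : inner ℝ (γ t) (∇ (spiralFun i) (γ t)) = γ t 0 * spiralPotentialX (i + 1) (γ t 0) (γ t 1) +
        γ t 1 * spiralPotentialY (i + 1) (γ t 0) (γ t 1) := by
      simp [gradient_spiralFun, PiLp.inner_apply, Fin.sum_univ_two]
      ring
    have hS' : γ t 0 ^ 2 + γ t 1 ^ 2 = S t := rfl
    rw [hin, radial_spiralPotential, (hXY t ht.le).1, (hXY t ht.le).2, hS']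
    push_cast
    rw [show (i : ℝ) + 1 + 3 = i + 4 by ring, ← he]
    have := (hpos t ht.le).ne'
    field_simp
    ring

end IsGradientTrajectory

/-! Subgradient trajectories of differentiable convex functions. -/

/-- On the segment from x to y, the derivative at the left end is at most the slope of the chord. -/
theorem ConvexOn.gradient_mem_subdifferential {f : Plane → ℝ} (hf : ConvexOn ℝ univ f)
    {x : Plane} (hd : DifferentiableAt ℝ f x) : ∇ f x ∈ subdifferential f x := by
  intro y
  have hl : HasDerivAt (fun t : ℝ ↦ x + t • (y - x)) (y - x) 0 := by
    simpa using! ((hasDerivAt_id (0 : ℝ)).smul_const (y - x)).const_add x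
  have hd' : HasFDerivAt f (fderiv ℝ f x) (x + (0 : ℝ) • (y - x)) := by simpa using hd.hasFDerivAt
  have h1 := hd'.comp_hasDerivAt 0 hl
  have hc : ConvexOn ℝ univ (f ∘ fun t : ℝ ↦ x + t • (y - x)) := by
    refine ⟨convex_univ, fun s _ t _ a b ha hb hab ↦ ?_⟩
    have h := hf.2 (mem_univ (x + s • (y - x))) (mem_univ (x + t • (y - x))) ha hb hab
    have e : a • (x + s • (y - x)) + b • (x + t • (y - x)) = x + (a • s + b • t) • (y - x) := by
      obtain rfl : a = 1 - b := by linarith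
      module
    rwa [e] at h
  have h2 := hc.le_slope_of_hasDerivAt (mem_univ 0) (mem_univ 1) one_pos h1
  have h3 : inner ℝ (∇ f x) (y - x) = fderiv ℝ f x (y - x) := by
    simp [gradient]
  rw [h3]
  simp only [slope_def_field, Function.comp, zero_smul, one_smul, add_zero, sub_zero, div_one,
    add_sub_cancel] at h2
  linarith

/-- A subgradient p makes f - ⟨p, ·⟩ minimal at x, where its derivative must vanish. -/
theorem eq_gradient_of_mem_subdifferential {f : Plane → ℝ} {x p : Plane}
    (hd : DifferentiableAt ℝ f x) (hp : p ∈ subdifferential f x) : p = ∇ f x := by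
  have hmin : IsLocalMin (fun y ↦ f y - inner ℝ p y) x := by
    refine Eventually.of_forall fun y ↦ ?_
    have := hp y
    rw [inner_sub_right] at this
    linarith
  have hg : HasFDerivAt (fun y ↦ f y - inner ℝ p y) (fderiv ℝ f x - innerSL ℝ p) x :=
    hd.hasFDerivAt.sub (innerSL ℝ p).hasFDerivAt
  have h0 := sub_eq_zero.1 (hmin.hasFDerivAt_eq_zero hg)
  refine ext_inner_right ℝ fun v ↦ ?_
  simp [gradient, h0]

theorem IsGradientTrajectory.isSubgradientTrajectory {f : Plane → ℝ} (hf : ConvexOn ℝ univ f)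
    (hd : Differentiable ℝ f) (hc : Continuous (∇ f)) {x₀ : Plane} {γ : ℝ → Plane}
    (h : IsGradientTrajectory f x₀ γ) : IsSubgradientTrajectory f x₀ γ := by
  have hder : ∀ t, 0 < t → HasDerivAt γ (-(∇ f (γ t))) t := fun t ht ↦
    (h.hasDeriv t ht.le).hasDerivAt (Ici_mem_nhds ht)
  have hcont : ContinuousOn (fun t ↦ -(∇ f (γ t))) (Ici 0) :=
    (hc.comp_continuousOn h.continuousOn).neg
  have hint : ∀ t₁ t₂ : ℝ, 0 ≤ t₁ → t₁ ≤ t₂ →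
      IntervalIntegrable (fun t ↦ -(∇ f (γ t))) volume t₁ t₂ := fun t₁ t₂ h1 h12 ↦
    (hcont.mono (by rw [uIcc_of_le h12]; exact fun t ht ↦ h1.trans ht.1)).intervalIntegrable
  have hcongr : ∀ t₁ t₂ : ℝ, 0 ≤ t₁ → t₁ ≤ t₂ → EqOn (fun t ↦ -(∇ f (γ t))) (deriv γ) (uIoc t₁ t₂) :=
    fun t₁ t₂ h1 h12 t ht ↦ by
      rw [uIoc_of_le h12] at ht
      exact (hder t (h1.trans_lt ht.1)).deriv.symm
  have hint' : ∀ t₁ t₂ : ℝ, 0 ≤ t₁ → t₁ ≤ t₂ → IntervalIntegrable (deriv γ) volume t₁ t₂ :=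
    fun t₁ t₂ h1 h12 ↦ (hint t₁ t₂ h1 h12).congr (hcongr t₁ t₂ h1 h12)
  refine ⟨h.initial, ?_, hint', fun t₁ t₂ h1 h12 ↦ ?_, ?_⟩
  · filter_upwards [ae_restrict_mem measurableSet_Ioi] with t ht using (hder t ht).differentiableAt
  · rw [intervalIntegral.integral_eq_sub_of_hasDerivAt_of_le h12
      (h.continuousOn.mono fun t ht ↦ h1.trans ht.1)
      (fun t ht ↦ (hder t (h1.trans_lt ht.1)).differentiableAt.hasDerivAt) (hint' t₁ t₂ h1 h12)]
    abel
  · filter_upwards [ae_restrict_mem measurableSet_Ioi] with t ht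
    rw [(hder t ht).deriv, neg_neg]
    exact hf.gradient_mem_subdifferential (hd _)

/-- The derivative equals -∇f(γ) almost everywhere, so γ is the integral of a continuous function
and is differentiable at every time. -/
theorem IsSubgradientTrajectory.isGradientTrajectory {f : Plane → ℝ}
    (hd : Differentiable ℝ f) (hc : Continuous (∇ f)) {x₀ : Plane} {γ : ℝ → Plane}
    (h : IsSubgradientTrajectory f x₀ γ) : IsGradientTrajectory f x₀ γ := by
  have hγ : ContinuousOn γ (Ici 0) := by
    intro t ht
    have ht1 : 0 ≤ t + 1 := by linarith [mem_Ici.1 ht]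
    have h1 := intervalIntegral.continuousOn_primitive_interval' (h.integrable 0 (t + 1) le_rfl ht1)
      left_mem_uIcc
    rw [uIcc_of_le ht1] at h1
    have h2 : ContinuousOn γ (Icc 0 (t + 1)) := ((continuousOn_const (c := γ 0)).add h1).congr
      fun u hu ↦ h.integral_eq 0 u le_rfl hu.1
    refine (h2 t ⟨ht, by linarith⟩).mono_of_mem_nhdsWithin ?_
    rw [← Ici_inter_Iic]
    exact inter_mem_nhdsWithin _ (Iic_mem_nhds (lt_add_one t))
  have hv : Continuous fun t ↦ -(∇ f (γ (max t 0))) :=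
    (hc.comp (hγ.comp_continuous (by fun_prop) fun t ↦ le_max_right t 0)).neg
  refine ⟨h.initial, fun t ht ↦ ?_⟩
  have hprim : HasDerivAt (fun u ↦ γ 0 + ∫ τ in (0 : ℝ)..u, -(∇ f (γ (max τ 0))))
      (-(∇ f (γ t))) t := by
    simpa [max_eq_left ht] using (hv.integral_hasStrictDerivAt 0 t).hasDerivAt.const_add (γ 0)
  refine hprim.hasDerivWithinAt.congr_of_mem (fun u hu ↦ ?_) ht
  have hu' : (0 : ℝ) ≤ u := hu
  rw [h.integral_eq 0 u le_rfl hu', add_right_inj]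
  refine intervalIntegral.integral_congr_ae ?_
  have hinc := (ae_restrict_iff' measurableSet_Ioi).1 h.inclusion
  filter_upwards [hinc] with τ hτ hmem
  rw [uIoc_of_le hu'] at hmem
  have := eq_gradient_of_mem_subdifferential (hd _) (hτ hmem.1)
  rw [max_eq_left hmem.1.le, ← this, neg_neg]

/-! Self-similarity of the sublevel sets. -/

/-- Halving r lowers 2 log r by 2 log 2, and rotating by log 2 raises 2θ by the same amount: the
phase is unchanged and only the power of r² scales. -/
theorem spiralFun_halfRotation (i : ℕ) (x : Plane) :
    spiralFun i (halfRotation (Real.log 2) x) = (1 / 4) ^ (i + 4) * spiralFun i x := by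
  rcases eq_or_ne x 0 with rfl | hx
  · have : halfRotation (Real.log 2) 0 = 0 := by
      ext k
      fin_cases k <;> simp [halfRotation]
    simp [this]
  have hs := Plane.sq_add_sq_pos hx
  set c := Real.cos (Real.log 2) with hc
  set d := Real.sin (Real.log 2) with hd
  have hcd : d ^ 2 + c ^ 2 = 1 := Real.sin_sq_add_cos_sq _
  have h0 : halfRotation (Real.log 2) x 0 = 1 / 2 * (c * x 0 - d * x 1) := by
    simp [halfRotation, hc, hd]
  have h1 : halfRotation (Real.log 2) x 1 = 1 / 2 * (d * x 0 + c * x 1) := by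
    simp [halfRotation, hc, hd]
  have hS : (1 / 2 * (c * x 0 - d * x 1)) ^ 2 + (1 / 2 * (d * x 0 + c * x 1)) ^ 2 =
      1 / 4 * (x 0 ^ 2 + x 1 ^ 2) := by
    linear_combination (1 / 4) * (x 0 ^ 2 + x 1 ^ 2) * hcd
  have hL : Real.log (1 / 4 * (x 0 ^ 2 + x 1 ^ 2)) =
      Real.log (x 0 ^ 2 + x 1 ^ 2) - 2 * Real.log 2 := by
    rw [Real.log_mul (by norm_num) hs.ne', show (1 / 4 : ℝ) = (2 ^ 2)⁻¹ by norm_num, Real.log_inv,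
      Real.log_pow]
    push_cast
    ring
  have hRe : spiralRe (1 / 2 * (c * x 0 - d * x 1)) (1 / 2 * (d * x 0 + c * x 1)) =
      1 / 4 * spiralRe (x 0) (x 1) := by
    rw [spiralRe, spiralRe, hS, hL, Real.cos_sub, Real.sin_sub, Real.cos_two_mul', Real.sin_two_mul,
      ← hc, ← hd]
    linear_combination (1 / 4) * ((x 0 ^ 2 - x 1 ^ 2) * Real.cos (Real.log (x 0 ^ 2 + x 1 ^ 2)) -
      2 * x 0 * x 1 * Real.sin (Real.log (x 0 ^ 2 + x 1 ^ 2))) * (d ^ 2 + c ^ 2 + 1) * hcd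
  rw [spiralFun, spiralFun, h0, h1, spiralPotential_eq, spiralPotential_eq, hS, hRe, mul_pow]
  ring

theorem halfRotation_surjective (α : ℝ) : Function.Surjective (halfRotation α) := by
  intro y
  refine ⟨(2 : ℝ) • !₂[Real.cos α * y 0 + Real.sin α * y 1,
    -Real.sin α * y 0 + Real.cos α * y 1], ?_⟩
  have h := Real.sin_sq_add_cos_sq α
  ext k
  fin_cases k
  · simp [halfRotation]
    linear_combination y 0 * h
  · simp [halfRotation]
    linear_combination y 1 * h

theorem isCompact_sublevel_spiralFun (i : ℕ) (c : ℝ) : IsCompact {x | spiralFun i x ≤ c} := by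
  refine Metric.isCompact_of_isClosed_isBounded
    (isClosed_le (differentiable_spiralFun i).continuous continuous_const) ?_
  refine (Metric.isBounded_closedBall (x := (0 : Plane)) (r := 1 + 2 * |c|)).subset fun x hx ↦ ?_
  rw [mem_closedBall_zero_iff]
  by_contra! hlt
  have h1 : (1 : ℝ) ≤ ‖x‖ := by linarith [abs_nonneg c]
  have h2 := (half_pow_le_spiralFun i x).trans hx
  rw [← Plane.norm_sq, ← pow_mul] at h2
  have h3 : ‖x‖ ≤ ‖x‖ ^ (2 * (i + 4)) := le_self_pow₀ h1 (by omega)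
  linarith [le_abs_self c]

theorem hasSelfSimilarSublevels_spiralFun : HasSelfSimilarSublevels (spiralFun 0) := by
  have hlog : Real.log 2 < Real.pi := by linarith [Real.log_two_lt_d9, Real.pi_gt_three]
  have hlt (k : ℕ) : (1 / 4 : ℝ) ^ (k + 1) < (1 / 4) ^ k :=
    pow_lt_pow_right_of_lt_one₀ (by norm_num) (by norm_num) (Nat.lt_succ_self k)
  -- For `i = 0` the similarity multiplies f by (1/4)^4, so levels in ratio 1/4 move by exactly four
  -- indices.
  refine ⟨Real.log 2, fun k ↦ {x | spiralFun 0 x ≤ (1 / 4) ^ k}, fun k ↦ (1 / 4) ^ k,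
    Real.log_pos one_lt_two, hlog, fun k ↦ ?_, fun k ↦ isCompact_sublevel_spiralFun 0 _, fun k ↦ ?_,
    fun k ↦ ?_, strictAnti_nat_of_succ_lt hlt, ?_, fun k ↦ rfl⟩
  · simpa using (convexOn_spiralFun 0).convex_le ((1 / 4) ^ k)
  · have hopen : IsOpen {x | spiralFun 0 x < (1 / 4) ^ k} :=
      isOpen_lt (differentiable_spiralFun 0).continuous continuous_const
    have hsub : {x | spiralFun 0 x < (1 / 4) ^ k} ⊆ {x | spiralFun 0 x ≤ (1 / 4) ^ k} :=
      Set.ofPred_subset_ofPred.2 fun _ ↦ le_of_lt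
    exact fun x hx ↦ interior_maximal hsub hopen (lt_of_le_of_lt hx (hlt k))
  · have key (x : Plane) : spiralFun 0 (halfRotation (Real.log 2) x) ≤ (1 / 4) ^ (k + 4) ↔
        spiralFun 0 x ≤ (1 / 4) ^ k := by
      rw [spiralFun_halfRotation, pow_add _ k, mul_comm ((1 / 4 : ℝ) ^ k)]
      exact mul_le_mul_iff_right₀ (by positivity)
    ext y
    constructor
    · intro hy
      obtain ⟨x, rfl⟩ := halfRotation_surjective (Real.log 2) y
      exact ⟨x, (key x).1 hy, rfl⟩
    · rintro ⟨x, hx, rfl⟩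
      exact (key x).2 hx
  · rw [spiralFun_zero]
    exact tendsto_pow_atTop_nhds_zero_of_lt_one (by norm_num) (by norm_num)

/-! ### Assembly of the main theorem -/

theorem IsGradientTrajectory.spirals {i : ℕ} {x₀ : Plane} {γ : ℝ → Plane}
    (h : IsGradientTrajectory (spiralFun i) x₀ γ) (hx₀ : x₀ ≠ 0) :
    Tendsto γ atTop (𝓝 0) ∧ SpiralsAround γ 0 ∧ ¬ SecantsConverge γ 0 :=
  ⟨h.tendsto_zero, h.spiralsAround hx₀, (h.spiralsAround hx₀).not_secantsConverge⟩

theorem mainTheorem8 :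
    -- a continuous convex function, with self-similar nested sublevel sets, all of whose
    -- subgradient trajectories spiral
    (∃ f : Plane → ℝ,
      Continuous f ∧ ConvexOn ℝ univ f ∧ (∀ x : Plane, x ≠ 0 → f 0 < f x) ∧
      HasSelfSimilarSublevels f ∧
      ∀ x₀ : Plane, x₀ ≠ 0 →
        (∃ γ : ℝ → Plane, IsSubgradientTrajectory f x₀ γ) ∧
        ∀ γ : ℝ → Plane, IsSubgradientTrajectory f x₀ γ →
          Tendsto γ atTop (𝓝 0) ∧ SpiralsAround γ 0 ∧ ¬ SecantsConverge γ 0) ∧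
    -- convex functions that are `C^∞` off the origin and `C^m` at the origin, all of whose
    -- gradient trajectories spiral
    (∀ m : ℕ, 1 ≤ m → ∃ f : Plane → ℝ,
      ContDiff ℝ m f ∧ ContDiffOn ℝ ∞ f {0}ᶜ ∧
      ConvexOn ℝ univ f ∧ (∀ x : Plane, x ≠ 0 → f 0 < f x) ∧
      ∀ x₀ : Plane, x₀ ≠ 0 →
        (∃ γ : ℝ → Plane, IsGradientTrajectory f x₀ γ) ∧
        ∀ γ : ℝ → Plane, IsGradientTrajectory f x₀ γ →
          Tendsto γ atTop (𝓝 0) ∧ SpiralsAround γ 0 ∧ ¬ SecantsConverge γ 0) := by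
  have hcg (i : ℕ) : Continuous (∇ (spiralFun i)) := (contDiff_gradient_spiralFun i).continuous
  have hmin (i : ℕ) (x : Plane) (hx : x ≠ 0) : spiralFun i 0 < spiralFun i x := by
    simpa using spiralFun_pos i hx
  refine ⟨⟨spiralFun 0, (differentiable_spiralFun 0).continuous, convexOn_spiralFun 0, hmin 0,
    hasSelfSimilarSublevels_spiralFun, fun x₀ hx₀ ↦ ⟨?_, fun γ hγ ↦ ?_⟩⟩, fun m _ ↦
    ⟨spiralFun m, (contDiff_spiralFun m).of_le (by norm_cast; omega), contDiffOn_spiralFun m,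
      convexOn_spiralFun m, hmin m, fun x₀ hx₀ ↦
        ⟨exists_isGradientTrajectory_spiralFun m x₀, fun γ hγ ↦ hγ.spirals hx₀⟩⟩⟩
  · obtain ⟨γ, hγ⟩ := exists_isGradientTrajectory_spiralFun 0 x₀
    exact ⟨γ, hγ.isSubgradientTrajectory (convexOn_spiralFun 0) (differentiable_spiralFun 0) (hcg 0)⟩
  · exact (hγ.isGradientTrajectory (differentiable_spiralFun 0) (hcg 0)).spirals hx₀
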